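/- For $n\in\mathbb N_0$ let $\omega(x)=e^{-x^2}$, let $H_n(x)=\frac{(-1)^n}{\omega(x)}\frac{d^n}{dx^n}\omega(x)$ be the Hermite polynomial of degree $n$, and let $$\Phi_n(z)=\frac1{2\pi i}\int_{\mathbb R}\frac{\omega(x)H_n(x)}{z-x}\,dx,\qquad z\in\mathbb C\setminus\mathbb R .$$ Then the following hold. (i) For every $n\in\mathbb N_0$ and $x\in\mathbb R$, the Cauchy principal value below exists and $$\lim_{\varepsilon\to0+}\left[\Phi_n(x-i\varepsilon)+\Phi_n(x+i\varepsilon)\right]=\frac1{\pi i}\,\mathrm{p.v.}\!\int_{\mathbb R}\frac{\omega(y)H_n(y)}{x-y}\,dy,\qquad \lim_{\varepsilon\to0+}\left[\Phi_n(x-i\varepsilon)-\Phi_n(x+i\varepsilon)\right]=\omega(x)H_n(x).$$ (ii) For every $n\in\mathbb N_0$, as $z\to\infty$ in $\mathbb C\setminus\mathbb R$, $$\Phi_n(z)=\frac{n!}{2\sqrt\pi\, i\, z^{n+1}}+O(z^{-n-2}).$$ (iii) Let $U(a,b;z)$ be Kummer's confluent hypergeometric function of the second kind (principal branch). For every $n\in\mathbb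 N_0$ and $z\in\mathbb C\setminus\mathbb R$, $$\Phi_n(z)=\frac{\Gamma(n+1)}{2\sqrt\pi}\,U\!\left(\frac{n+1}2,\frac12;-z^2\right)\cdot\begin{cases}e^{-(n+2)\pi i/2},&\operatorname{Im}z>0,\\ e^{n\pi i/2},&\operatorname{Im}z<0.\end{cases}$$ (iv) For every fixed $z\in\mathbb C\setminus\mathbb R$, as $n\to\infty$, $$|\Phi_n(z)|=\frac{\Gamma(n+1)\,|e^{-z^2/2}|}{\Gamma\!\left(\frac{n+1}2\right)\sqrt{2(n+1)}}\,e^{-|\operatorname{Im}z|\sqrt{2(n+1)}}\left(1+O(n^{-1/2})\right).$$ -/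

import Mathlib

open Filter Topology Asymptotics MeasureTheory

noncomputable section

/-- The Hermite weight `ω(x) = exp (-x²)`. -/
def hermiteWeight (x : ℝ) : ℝ := Real.exp (-x ^ 2)

/-- The (physicists') Hermite polynomial `H_n`, by Rodrigues' formula
`H_n(x) = ((-1)^n / ω(x)) * (dⁿω/dxⁿ)(x)`. -/
def hermiteH (n : ℕ) (x : ℝ) : ℝ :=
  (-1) ^ n / hermiteWeight x * iteratedDeriv n hermiteWeight x

/-- The weighted Cauchy transform
`Φ_n(z) = (1 / (2πi)) ∫_ℝ ω(x) H_n(x) / (z - x) dx` for `z` not real. -/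
def hermiteCauchy (n : ℕ) (z : ℂ) : ℂ :=
  1 / (2 * (Real.pi : ℂ) * Complex.I) *
    ∫ x : ℝ, ((hermiteWeight x * hermiteH n x : ℝ) : ℂ) / (z - (x : ℂ))

/-- The Cauchy principal value of `∫_ℝ f`, with the singularity at `x`, exists and equals `L`:
`f` is integrable off each interval `[x - δ, x + δ]`, and the integrals over the complements
of these intervals tend to `L` as `δ → 0+`. -/
def HasCauchyPV (f : ℝ → ℝ) (x L : ℝ) : Prop :=
  (∀ δ : ℝ, 0 < δ → IntegrableOn f {y : ℝ | δ < |y - x|}) ∧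
    Tendsto (fun δ : ℝ => ∫ y in {y : ℝ | δ < |y - x|}, f y) (𝓝[>] 0) (𝓝 L)

/-- The combination
`π / sin(πb) * (𝐌(a, b; z) / Γ(a-b+1) - z^(1-b) 𝐌(a-b+1, 2-b; z) / Γ(a))`, meaningful for
`b ∉ ℤ`, with the principal branch of the power. Here
`𝐌(a, b; z) = ∑_k (a)_k / Γ(b+k) * z^k / k!` is the regularized Kummer function of the first
kind `M(a, b; z) / Γ(b)`. As `Γ` has value `0` at its poles, `x / Γ(s)` is `0` there, as it
should be. -/
def kummerUComb (a b z : ℂ) : ℂ :=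
  (Real.pi : ℂ) / Complex.sin ((Real.pi : ℂ) * b) *
    (Complex.regularizedHGFun {a} {b} z / Complex.Gamma (a - b + 1) -
      z ^ (1 - b) * Complex.regularizedHGFun {a - b + 1} {2 - b} z / Complex.Gamma a)

open Classical in
/-- Kummer's function of the second kind `U(a, b; z)` (principal branch, `z ≠ 0`): the above
combination for `b ∉ ℤ`, extended to `b ∈ ℤ` by continuity in `b`. -/
def kummerU (a b z : ℂ) : ℂ :=
  if ∃ m : ℤ, b = (m : ℂ) then limUnder (𝓝[≠] b) (fun β : ℂ => kummerUComb a β z)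
  else kummerUComb a b z

end

/-!
Everything is read off from one representation. In the upper half plane
`1 / (z - x) = -i ∫_0^∞ exp (i t (z - x)) dt`, and `ω H_n = (-1)^n ω^{(n)}` has Fourier transform
`(-i t)^n √π exp (-t²/4)`; by Fubini `Φ_n(z) = -(-i)^n / (2√π) * J_n(-iz)` with the parabolic
cylinder integral `J_n(s) = ∫_0^∞ t^n exp (-t²/4 - s t) dt`
(`hermiteCauchy_of_im_pos`). The lower half plane follows from `Φ_n(-z) = (-1)^(n+1) Φ_n(z)`
(`hermiteCauchy_neg`).

* The Plemelj relations use only that `ω H_n` is bounded, integrable and Lipschitz: the difference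
  of the two boundary values is a Poisson integral, and their sum, like the principal value, is an
  integral against an odd kernel, hence an integral of the symmetric difference quotient against a
  bounded even factor tending to `1` (`tendsto_integral_mul_odd`).
* Integration by parts gives `s J_n = 0^n + n J_{n-1} - J_{n+1} / 2` (`mul_cylInt`). Each use of it
  gains a factor `1 / s`, uniformly for `0 ≤ re s`, so `J_n(s) = n! / s^(n+1) + O(s^{-n-2})` up to
  the imaginary axis, which corresponds to real `z`.
* Expanding `exp (-s t)` gives `J_n` as a power series whose coefficients are values of `Γ`; its
  even and odd parts are the two Kummer functions in the definition of `U` (`cylInt_eq_kummerU`).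
* For large `n` the integrand of `J_n` peaks at `t = √(2n)`. Recentred and normalized there it
  differs from `exp (-u²/2)` by at most a constant times `|u|³ exp (-u²/4) / √n`
  (`abs_peak_sub_le`), which is Laplace's method with an error term. The height of the peak is
  eliminated by comparison with `J_n(0) = 2^n Γ((n+1)/2)`, so Stirling's formula is not needed;
  log-convexity of `Γ` estimates the remaining ratio `Γ((n+1)/2) / Γ((n+2)/2)`.
-/

namespace HermiteCauchy

open Complex (I)

/-! ### Hermite functions -/

/-- The Hermite function `ω H_n`, which is `(-1)^n` times the `n`-th derivative of `ω`. -/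
noncomputable def hermiteFun (n : ℕ) (x : ℝ) : ℝ := hermiteWeight x * hermiteH n x

lemma hermiteFun_eq_iteratedDeriv (n : ℕ) (x : ℝ) :
    hermiteFun n x = (-1) ^ n * iteratedDeriv n hermiteWeight x := by
  have : hermiteWeight x ≠ 0 := (Real.exp_pos _).ne'
  unfold hermiteFun hermiteH
  field_simp

lemma hermiteFun_zero (x : ℝ) : hermiteFun 0 x = Real.exp (-x ^ 2) := by
  simp [hermiteFun_eq_iteratedDeriv, hermiteWeight]

lemma hasDerivAt_hermiteFun (n : ℕ) (x : ℝ) :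
    HasDerivAt (hermiteFun n) (-hermiteFun (n + 1) x) x := by
  have hc : ContDiff ℝ ((n + 1 : ℕ) : WithTop ℕ∞) hermiteWeight := by
    unfold hermiteWeight; fun_prop
  have h := (hc.differentiable_iteratedDeriv n (by exact_mod_cast Nat.lt_succ_self n) x).hasDerivAt
  rw [← iteratedDeriv_succ] at h
  have h2 := h.const_mul ((-1 : ℝ) ^ n)
  rw [show hermiteFun n = fun y => (-1 : ℝ) ^ n * iteratedDeriv n hermiteWeight y from
    funext (hermiteFun_eq_iteratedDeriv n), hermiteFun_eq_iteratedDeriv]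
  exact h2.congr_deriv (by ring)

lemma continuous_hermiteFun (n : ℕ) : Continuous (hermiteFun n) :=
  continuous_iff_continuousAt.2 fun x => (hasDerivAt_hermiteFun n x).continuousAt

lemma hermiteFun_neg (n : ℕ) (x : ℝ) : hermiteFun n (-x) = (-1) ^ n * hermiteFun n x := by
  have h := iteratedDeriv_comp_neg n hermiteWeight x
  rw [show (fun x => hermiteWeight (-x)) = hermiteWeight by ext; simp [hermiteWeight]] at h
  rw [hermiteFun_eq_iteratedDeriv, hermiteFun_eq_iteratedDeriv, h, smul_eq_mul,
    ← mul_assoc ((-1 : ℝ) ^ n) ((-1) ^ n), ← mul_pow]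
  simp

lemma exists_hermiteFun_eq_polynomial (n : ℕ) :
    ∃ p : Polynomial ℝ, ∀ x, hermiteFun n x = p.eval x * Real.exp (-x ^ 2) := by
  induction n with
  | zero => exact ⟨1, fun x => by simp [hermiteFun_zero]⟩
  | succ n ih =>
    obtain ⟨p, hp⟩ := ih
    refine ⟨2 * Polynomial.X * p - p.derivative, fun x => ?_⟩
    have h1 := hasDerivAt_hermiteFun n x
    rw [funext hp] at h1
    have h2 := (p.hasDerivAt x).mul (((hasDerivAt_pow 2 x).neg).exp)
    have h3 := h1.unique h2
    simp only [Polynomial.eval_sub, Polynomial.eval_mul, Polynomial.eval_X,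
      Polynomial.eval_ofNat]
    simp only [Pi.neg_apply, Nat.cast_ofNat, Nat.add_one_sub_one, pow_one] at h3
    linear_combination -h3

lemma exists_abs_polynomial_le (p : Polynomial ℝ) :
    ∃ C, ∀ x : ℝ, |p.eval x| ≤ C * Real.exp (1 / 2 * x ^ 2) := by
  induction p using Polynomial.induction_on' with
  | add p q hp hq =>
    obtain ⟨C, hC⟩ := hp
    obtain ⟨D, hD⟩ := hq
    refine ⟨C + D, fun x => ?_⟩
    rw [Polynomial.eval_add, add_mul]
    exact (abs_add_le _ _).trans (add_le_add (hC x) (hD x))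
  | monomial k a =>
    refine ⟨|a| * (k.factorial * Real.exp (1 / 2)), fun x => ?_⟩
    have h1 := Real.pow_div_factorial_le_exp |x| (abs_nonneg x) k
    rw [div_le_iff₀ (by positivity)] at h1
    -- `|x| ≤ 1 / 2 + x² / 2`
    have h2 : Real.exp |x| ≤ Real.exp (1 / 2) * Real.exp (1 / 2 * x ^ 2) := by
      rw [← Real.exp_add]
      gcongr
      nlinarith [sq_nonneg (|x| - 1), sq_abs x]
    rw [Polynomial.eval_monomial, abs_mul, abs_pow]
    calc |a| * |x| ^ k ≤ |a| * (Real.exp |x| * k.factorial) := by gcongr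
      _ ≤ |a| * (Real.exp (1 / 2) * Real.exp (1 / 2 * x ^ 2) * k.factorial) := by gcongr
      _ = _ := by ring

lemma exists_abs_hermiteFun_le (n : ℕ) :
    ∃ C, ∀ x, |hermiteFun n x| ≤ C * Real.exp (-(1 / 2) * x ^ 2) := by
  obtain ⟨p, hp⟩ := exists_hermiteFun_eq_polynomial n
  obtain ⟨C, hC⟩ := exists_abs_polynomial_le p
  refine ⟨C, fun x => ?_⟩
  rw [hp, abs_mul, Real.abs_exp]
  calc _ ≤ C * Real.exp (1 / 2 * x ^ 2) * Real.exp (-x ^ 2) := by gcongr; exact hC x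
    _ = _ := by rw [mul_assoc, ← Real.exp_add]; ring_nf

lemma integrable_hermiteFun (n : ℕ) : Integrable (hermiteFun n) := by
  obtain ⟨C, hC⟩ := exists_abs_hermiteFun_le n
  exact ((integrable_exp_neg_mul_sq (by norm_num : (0 : ℝ) < 1 / 2)).const_mul C).mono'
    (continuous_hermiteFun n).aestronglyMeasurable (ae_of_all _ fun x => hC x)

lemma exists_abs_hermiteFun_le_const (n : ℕ) : ∃ C, 0 ≤ C ∧ ∀ x, |hermiteFun n x| ≤ C := by
  obtain ⟨C, hC⟩ := exists_abs_hermiteFun_le n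
  have h0 : 0 ≤ C := by simpa using (abs_nonneg _).trans (hC 0)
  refine ⟨C, h0, fun x => (hC x).trans (mul_le_of_le_one_right h0 ?_)⟩
  rw [Real.exp_le_one_iff]
  nlinarith [sq_nonneg x]

lemma exists_abs_hermiteFun_sub_le (n : ℕ) :
    ∃ K, 0 ≤ K ∧ ∀ x y, |hermiteFun n x - hermiteFun n y| ≤ K * |x - y| := by
  obtain ⟨K, h0, hK⟩ := exists_abs_hermiteFun_le_const (n + 1)
  refine ⟨K, h0, fun x y => ?_⟩
  have := Convex.norm_image_sub_le_of_norm_hasDerivWithin_le (s := Set.univ) (C := K) (x := y)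
    (y := x) (fun z _ => (hasDerivAt_hermiteFun n z).hasDerivWithinAt)
    (fun z _ => by rw [norm_neg]; exact hK z) convex_univ trivial trivial
  simpa using this

/-- The Fourier transform of the Hermite functions. -/
lemma integral_hermiteFun_mul_exp (n : ℕ) (t : ℝ) :
    ∫ x : ℝ, (hermiteFun n x : ℂ) * Complex.exp (-I * t * x) =
      (-I * t) ^ n * (Real.sqrt Real.pi * Complex.exp (-t ^ 2 / 4)) := by
  have hexp : ∀ x : ℝ, ‖Complex.exp (-I * t * x)‖ = 1 := fun x => by
    rw [Complex.norm_exp]; simp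
  have hint : ∀ m, Integrable fun x : ℝ => (hermiteFun m x : ℂ) * Complex.exp (-I * t * x) :=
    fun m => ((integrable_hermiteFun m).ofReal (𝕜 := ℂ)).mul_bdd (c := 1)
      (by fun_prop) (ae_of_all _ fun x => (hexp x).le)
  induction n with
  | zero =>
    have h := fourierIntegral_gaussian (b := 1) (by simp) (-t)
    rw [pow_zero, one_mul]
    convert h using 2
    · ext x
      rw [hermiteFun_zero, mul_comm]
      congr 2
      · ring
      · push_cast; ring_nf
    · rw [div_one, Real.sqrt_eq_rpow, Complex.ofReal_cpow Real.pi_pos.le]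
      norm_num
    · ring_nf
  | succ n ih =>
    have h := integral_mul_deriv_eq_deriv_mul_of_integrable
      (u := fun x : ℝ => Complex.exp (-I * t * x))
      (u' := fun x : ℝ => (-I * t) * Complex.exp (-I * t * x))
      (v := fun x : ℝ => (hermiteFun n x : ℂ))
      (v' := fun x : ℝ => ((-hermiteFun (n + 1) x : ℝ) : ℂ))
      (fun x _ => by
        have := ((Complex.ofRealCLM.hasDerivAt (x := x)).const_mul (-I * t)).cexp
        simpa [mul_comm] using this)
      (fun x _ => (hasDerivAt_hermiteFun n x).ofReal_comp)
      (by
        refine (hint (n + 1)).neg.congr (ae_of_all _ fun x => ?_)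
        simp [mul_comm])
      (by
        refine ((hint n).const_mul (-I * t)).congr (ae_of_all _ fun x => ?_)
        simp; ring)
      (by
        refine (hint n).congr (ae_of_all _ fun x => ?_)
        simp [mul_comm])
    rw [pow_succ', mul_assoc, ← ih, ← integral_const_mul]
    simp only [Complex.ofReal_neg, mul_neg, integral_neg, neg_inj] at h
    simp_rw [mul_comm (Complex.ofReal _) (Complex.exp _)]
    rw [h]
    congr 1; ext x; ring

/-! ### The parabolic cylinder integral -/

/-- The integral `J_n(s) = ∫_0^∞ t^n exp (-t²/4 - s t) dt`, a parabolic cylinder function up to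
normalization. It converges for every complex `s`. -/
noncomputable def cylInt (n : ℕ) (s : ℂ) : ℂ :=
  ∫ t : ℝ in Set.Ioi 0, (t : ℂ) ^ n * Complex.exp (-t ^ 2 / 4 - s * t)

lemma integrableOn_pow_mul_exp (n : ℕ) (r : ℝ) :
    IntegrableOn (fun t : ℝ => t ^ n * Real.exp (-t ^ 2 / 4 - r * t)) (Set.Ioi 0) := by
  -- `t^n ≤ n! exp t` leaves a Gaussian with shifted linear term as majorant
  have h := (integrable_cexp_quadratic' (b := -1 / 4) (by norm_num) (1 - r : ℝ) 0).norm
  refine Integrable.mono' (h.const_mul (n.factorial : ℝ)).integrableOn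
    (by fun_prop) ?_
  filter_upwards [ae_restrict_mem measurableSet_Ioi] with t (ht : 0 < t)
  have h1 := Real.pow_div_factorial_le_exp t ht.le n
  rw [div_le_iff₀ (by positivity)] at h1
  rw [Complex.norm_exp, Real.norm_of_nonneg (by positivity)]
  have e : (-1 / 4 * (t : ℂ) ^ 2 + ((1 - r : ℝ) : ℂ) * t + 0).re = -t ^ 2 / 4 + (1 - r) * t := by
    have : (-1 / 4 * (t : ℂ) ^ 2 + ((1 - r : ℝ) : ℂ) * t + 0) =
      ((-t ^ 2 / 4 + (1 - r) * t : ℝ) : ℂ) := by push_cast; ring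
    rw [this, Complex.ofReal_re]
  rw [e]
  calc _ ≤ Real.exp t * n.factorial * Real.exp (-t ^ 2 / 4 - r * t) := by gcongr
    _ = n.factorial * (Real.exp t * Real.exp (-t ^ 2 / 4 - r * t)) := by ring
    _ = _ := by rw [← Real.exp_add]; ring_nf

lemma norm_exp_cylInt (s : ℂ) (t : ℝ) :
    ‖Complex.exp (-(t : ℂ) ^ 2 / 4 - s * t)‖ = Real.exp (-t ^ 2 / 4 - s.re * t) := by
  rw [Complex.norm_exp]
  congr 1
  have : (-(t : ℂ) ^ 2 / 4 - s * t) = ((-t ^ 2 / 4 : ℝ) : ℂ) - s * t := by push_cast; ring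
  rw [this, Complex.sub_re, Complex.ofReal_re, Complex.re_mul_ofReal]

lemma integrableOn_cylInt (n : ℕ) (s : ℂ) :
    IntegrableOn (fun t : ℝ => (t : ℂ) ^ n * Complex.exp (-t ^ 2 / 4 - s * t)) (Set.Ioi 0) := by
  refine (integrableOn_pow_mul_exp n s.re).mono' (by fun_prop) ?_
  filter_upwards [ae_restrict_mem measurableSet_Ioi] with t (ht : 0 < t)
  rw [norm_mul, norm_exp_cylInt, norm_pow, Complex.norm_real, Real.norm_of_nonneg ht.le]

lemma hermiteCauchy_eq (n : ℕ) (z : ℂ) : hermiteCauchy n z =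
    1 / (2 * (Real.pi : ℂ) * I) * ∫ x : ℝ, (hermiteFun n x : ℂ) / (z - (x : ℂ)) := rfl

/-- In the upper half plane `1 / (z - x) = -i ∫_0^∞ exp (i t (z - x)) dt`, so the Cauchy transform
is a Laplace transform of the Fourier transform of the Hermite function. -/
lemma hermiteCauchy_of_im_pos (n : ℕ) {z : ℂ} (hz : 0 < z.im) :
    hermiteCauchy n z = -(-I) ^ n / (2 * Real.sqrt Real.pi) * cylInt n (-I * z) := by
  have hre : (I * z).re < 0 := by simpa using hz
  have h1 : ∀ x : ℝ, (hermiteFun n x : ℂ) / (z - x) =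
      -I * ∫ t : ℝ in Set.Ioi 0, (hermiteFun n x : ℂ) * Complex.exp (I * (z - x) * t) := by
    intro x
    have hx : z - x ≠ 0 := fun h => by
      have := congrArg Complex.im h; simp at this; exact hz.ne' this
    rw [integral_const_mul, integral_exp_mul_complex_Ioi (by simpa using hz)]
    simp
    field_simp
  have hint : Integrable (Function.uncurry fun (x t : ℝ) =>
      (hermiteFun n x : ℂ) * Complex.exp (I * (z - x) * t))
      (volume.prod (volume.restrict (Set.Ioi 0))) := by
    have h := ((integrable_hermiteFun n).ofReal (𝕜 := ℂ)).mul_prod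
      (integrableOn_exp_mul_complex_Ioi hre 0)
    refine h.mono ?_ (ae_of_all _ fun p => ?_)
    · have := continuous_hermiteFun n
      apply Continuous.aestronglyMeasurable
      fun_prop
    · simp [Function.uncurry, Complex.norm_exp]
  rw [hermiteCauchy_eq, integral_congr_ae (ae_of_all _ h1), integral_const_mul,
    integral_integral_swap hint]
  have h2 : ∀ t : ℝ, ∫ x : ℝ, (hermiteFun n x : ℂ) * Complex.exp (I * (z - x) * t) =
      (-I) ^ n * Real.sqrt Real.pi * ((t : ℂ) ^ n * Complex.exp (-t ^ 2 / 4 - (-I * z) * t)) := by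
    intro t
    have : ∀ x : ℝ, (hermiteFun n x : ℂ) * Complex.exp (I * (z - x) * t) =
        Complex.exp (I * z * t) * ((hermiteFun n x : ℂ) * Complex.exp (-I * t * x)) := by
      intro x
      rw [mul_left_comm, ← Complex.exp_add]
      ring_nf
    simp_rw [this]
    rw [integral_const_mul, integral_hermiteFun_mul_exp, mul_pow,
      show -(t : ℂ) ^ 2 / 4 - (-I * z) * t = I * z * t + -(t : ℂ) ^ 2 / 4 by ring, Complex.exp_add]
    ring
  simp_rw [h2]
  rw [integral_const_mul, ← cylInt]
  have hpi : (Real.pi : ℂ) = (Real.sqrt Real.pi : ℂ) ^ 2 := by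
    rw [← Complex.ofReal_pow, Real.sq_sqrt Real.pi_pos.le]
  have hs : (Real.sqrt Real.pi : ℂ) ≠ 0 := by
    simpa using (Real.sqrt_pos.2 Real.pi_pos).ne'
  rw [hpi]
  field_simp

lemma hermiteCauchy_neg (n : ℕ) (z : ℂ) :
    hermiteCauchy n (-z) = (-1) ^ (n + 1) * hermiteCauchy n z := by
  have h : ∫ x : ℝ, (hermiteFun n x : ℂ) / (-z - x) =
      (-1) ^ (n + 1) * ∫ x : ℝ, (hermiteFun n x : ℂ) / (z - x) := by
    rw [← integral_neg_eq_self, ← integral_const_mul]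
    refine integral_congr_ae (ae_of_all _ fun x => ?_)
    dsimp only
    rw [hermiteFun_neg, Complex.ofReal_neg, show -z - -(x : ℂ) = -(z - x) by ring, div_neg]
    push_cast
    ring
  rw [hermiteCauchy_eq, hermiteCauchy_eq, h, mul_left_comm]

/-! ### Boundary values -/

/-- The Poisson kernel is an approximate identity. -/
lemma tendsto_integral_mul_poisson {F : ℝ → ℝ} (hc : Continuous F) {C : ℝ} (hC : ∀ y, |F y| ≤ C)
    (x : ℝ) :
    Tendsto (fun ε : ℝ => ∫ y, F y * (ε / ((x - y) ^ 2 + ε ^ 2))) (𝓝[>] 0)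
      (𝓝 (Real.pi * F x)) := by
  -- the substitution `y = x - ε u`
  have h1 : ∀ ε : ℝ, 0 < ε → ∫ u, F (x - ε * u) * (1 + u ^ 2)⁻¹ =
      ∫ y, F y * (ε / ((x - y) ^ 2 + ε ^ 2)) := by
    intro ε hε
    rw [← integral_sub_left_eq_self (fun y => F y * (ε / ((x - y) ^ 2 + ε ^ 2))) volume x]
    have h := Measure.integral_comp_mul_left
      (fun v => F (x - v) * (ε / ((x - (x - v)) ^ 2 + ε ^ 2))) ε
    rw [abs_of_pos (inv_pos.2 hε), smul_eq_mul, ← div_eq_inv_mul, eq_div_iff hε.ne',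
      ← integral_mul_const] at h
    rw [← h]
    refine integral_congr_ae (ae_of_all _ fun u => ?_)
    have : (1 : ℝ) + u ^ 2 ≠ 0 := by positivity
    have h2 : (ε * u) ^ 2 + ε ^ 2 ≠ 0 := by positivity
    simp only [sub_sub_cancel]
    field_simp
    ring
  have h2 : Tendsto (fun ε : ℝ => ∫ u, F (x - ε * u) * (1 + u ^ 2)⁻¹) (𝓝[>] 0)
      (𝓝 (∫ u, F x * (1 + u ^ 2)⁻¹)) := by
    refine tendsto_integral_filter_of_dominated_convergence (fun u => C * (1 + u ^ 2)⁻¹)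
      (.of_forall fun ε => ?_) (.of_forall fun ε => ae_of_all _ fun u => ?_)
      (integrable_inv_one_add_sq.const_mul C) (ae_of_all _ fun u => ?_)
    · exact (Measurable.mul (by fun_prop) (by fun_prop)).aestronglyMeasurable
    · rw [Real.norm_eq_abs, abs_mul, abs_of_nonneg (a := (1 + u ^ 2)⁻¹) (by positivity)]
      gcongr
      exact hC _
    · refine Tendsto.mul_const _ ?_
      have : Continuous fun ε : ℝ => F (x - ε * u) := by fun_prop
      simpa using (this.tendsto 0).mono_left nhdsWithin_le_nhds
  rw [integral_const_mul, integral_univ_inv_one_add_sq, mul_comm] at h2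
  refine h2.congr' ?_
  filter_upwards [self_mem_nhdsWithin] with ε hε using h1 ε hε

/-- The symmetric difference quotient of a Lipschitz integrable function is integrable. -/
lemma integrable_symm_quotient {F : ℝ → ℝ} (hc : Continuous F) (hi : Integrable F) {K : ℝ}
    (hK : ∀ y z, |F y - F z| ≤ K * |y - z|) (x : ℝ) :
    Integrable fun u => (F (x - u) - F (x + u)) / u := by
  -- the Lipschitz bound dominates for `|u| ≤ 1`, integrability of `F` for `|u| ≥ 1`
  have h1 : Integrable fun u => |F (x - u)| + |F (x + u)| :=
    (hi.comp_sub_left x).abs.add (hi.comp_add_left x).abs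
  have h2 : Integrable ((Set.Icc (-1 : ℝ) 1).indicator fun _ => 2 * K) :=
    (integrable_indicator_iff measurableSet_Icc).2 continuous_const.integrableOn_Icc
  refine (h2.add h1).mono' ?_ (ae_of_all _ fun u => ?_)
  · exact (Measurable.div (by fun_prop) (by fun_prop)).aestronglyMeasurable
  have hK0 : 0 ≤ K := by simpa using (abs_nonneg _).trans (hK 1 0)
  rw [Pi.add_apply, Real.norm_eq_abs, abs_div]
  by_cases hu : u ∈ Set.Icc (-1 : ℝ) 1
  · rw [Set.indicator_of_mem hu]
    have h3 : |F (x - u) - F (x + u)| / |u| ≤ 2 * K := by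
      rcases eq_or_ne u 0 with rfl | h0
      · simpa using hK0
      rw [div_le_iff₀ (abs_pos.2 h0)]
      refine (hK _ _).trans_eq ?_
      rw [show x - u - (x + u) = -(2 * u) by ring, abs_neg, abs_mul, abs_two]
      ring
    linarith [abs_nonneg (F (x - u)), abs_nonneg (F (x + u))]
  · rw [Set.indicator_of_notMem hu, zero_add]
    have h4 : 1 ≤ |u| := by
      by_contra! h
      exact hu ⟨(abs_lt.1 h).1.le, (abs_lt.1 h).2.le⟩
    exact (div_le_self (abs_nonneg _) h4).trans (abs_sub _ _)

/-- Folding an integral against an odd kernel. -/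
lemma integral_mul_odd {F k : ℝ → ℝ} (hk : ∀ u, k (-u) = -k u) (x : ℝ)
    (hi : Integrable fun y => F y * k (x - y)) :
    ∫ y, F y * k (x - y) = 1 / 2 * ∫ u, (F (x - u) - F (x + u)) * k u := by
  have h1 : Integrable fun u => F (x - u) * k u := by simpa using hi.comp_sub_left x
  have h2 : ∫ u, F (x - u) * k u = ∫ y, F y * k (x - y) := by
    simpa using integral_sub_left_eq_self (fun y => F y * k (x - y)) volume x
  have h3 : Integrable fun u => -(F (x + u) * k u) := by
    refine h1.comp_neg.congr (ae_of_all _ fun u => ?_)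
    simp [hk]
  have h4 : ∫ u, -(F (x + u) * k u) = ∫ y, F y * k (x - y) := by
    rw [← h2, ← integral_neg_eq_self (fun u => F (x - u) * k u)]
    simp [hk]
  have h5 := integral_add h1 h3
  rw [h2, h4] at h5
  rw [show (fun u => (F (x - u) - F (x + u)) * k u) =
    fun u => F (x - u) * k u + -(F (x + u) * k u) by ext; ring, h5]
  ring

/-- If odd kernels `κ(ε, u) / u`, with `|κ| ≤ 1`, approach the kernel `1 / u` pointwise, then the
integrals against them tend to half the integral of the symmetric difference quotient. -/
lemma tendsto_integral_mul_odd {F : ℝ → ℝ} (hc : Continuous F) (hi : Integrable F) {K : ℝ}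
    (hK : ∀ y z, |F y - F z| ≤ K * |y - z|) (x : ℝ) {κ : ℝ → ℝ → ℝ}
    (hm : ∀ ε, Measurable (κ ε)) (heven : ∀ ε u, κ ε (-u) = κ ε u) (hκ : ∀ ε u, |κ ε u| ≤ 1)
    (hlim : ∀ u, u ≠ 0 → Tendsto (fun ε => κ ε u) (𝓝[>] 0) (𝓝 1))
    (hint : ∀ ε, 0 < ε → Integrable fun y => F y * (κ ε (x - y) / (x - y))) :
    Tendsto (fun ε : ℝ => ∫ y, F y * (κ ε (x - y) / (x - y))) (𝓝[>] 0)
      (𝓝 (1 / 2 * ∫ u, (F (x - u) - F (x + u)) / u)) := by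
  have hG := integrable_symm_quotient hc hi hK x
  have h : Tendsto (fun ε : ℝ => 1 / 2 * ∫ u, (F (x - u) - F (x + u)) / u * κ ε u) (𝓝[>] 0)
      (𝓝 (1 / 2 * ∫ u, (F (x - u) - F (x + u)) / u)) := by
    refine Tendsto.const_mul _ ?_
    refine tendsto_integral_filter_of_dominated_convergence
      (fun u => |(F (x - u) - F (x + u)) / u|)
      (.of_forall fun ε => hG.aestronglyMeasurable.mul (hm ε).aestronglyMeasurable)
      (.of_forall fun ε => ae_of_all _ fun u => ?_) hG.abs ?_
    · rw [Real.norm_eq_abs, abs_mul]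
      exact mul_le_of_le_one_right (abs_nonneg _) (hκ ε u)
    · filter_upwards [volume.ae_ne (0 : ℝ)] with u hu
      simpa using (hlim u hu).const_mul ((F (x - u) - F (x + u)) / u)
  refine h.congr' ?_
  filter_upwards [self_mem_nhdsWithin] with ε hε
  rw [integral_mul_odd (k := fun u => κ ε u / u) (fun u => by rw [heven, div_neg]) x (hint ε hε)]
  congr 2
  ext u
  ring

lemma integrable_hermiteFun_div (n : ℕ) {z : ℂ} (hz : z.im ≠ 0) :
    Integrable fun y : ℝ => (hermiteFun n y : ℂ) / (z - y) := by
  have h0 : ∀ y : ℝ, z - y ≠ 0 := fun y h => hz (by simpa using congrArg Complex.im h)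
  have := continuous_hermiteFun n
  simp_rw [div_eq_mul_inv]
  refine ((integrable_hermiteFun n).ofReal (𝕜 := ℂ)).mul_bdd (c := |z.im|⁻¹) ?_
    (ae_of_all _ fun y => ?_)
  · exact (Continuous.inv₀ (by fun_prop) h0).aestronglyMeasurable
  · rw [norm_inv]
    gcongr
    simpa using Complex.abs_im_le_norm (z - y)

lemma hermiteCauchy_sub (n : ℕ) (x : ℝ) {ε : ℝ} (hε : 0 < ε) :
    hermiteCauchy n (x - I * ε) - hermiteCauchy n (x + I * ε) =
      ((1 / Real.pi * ∫ y, hermiteFun n y * (ε / ((x - y) ^ 2 + ε ^ 2)) : ℝ) : ℂ) := by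
  rw [hermiteCauchy_eq, hermiteCauchy_eq, ← mul_sub,
    ← integral_sub (integrable_hermiteFun_div n (by simp [hε.ne']))
      (integrable_hermiteFun_div n (by simp [hε.ne'])), Complex.ofReal_mul,
      ← integral_complex_ofReal, ← integral_const_mul, ← integral_const_mul]
  refine integral_congr_ae (ae_of_all _ fun y => ?_)
  have h1 : (x : ℂ) - I * ε - y ≠ 0 := fun h => hε.ne' (by simpa using congrArg Complex.im h)
  have h2 : (x : ℂ) + I * ε - y ≠ 0 := fun h => hε.ne' (by simpa using congrArg Complex.im h)
  have h3 : ((x : ℂ) - y) ^ 2 + ε ^ 2 = (x - I * ε - y) * (x + I * ε - y) := by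
    linear_combination (ε : ℂ) ^ 2 * Complex.I_sq
  have hpi : (Real.pi : ℂ) ≠ 0 := by simp
  push_cast
  rw [h3]
  field_simp
  ring

lemma hermiteCauchy_add (n : ℕ) (x : ℝ) {ε : ℝ} (hε : 0 < ε) :
    hermiteCauchy n (x - I * ε) + hermiteCauchy n (x + I * ε) =
      1 / (Real.pi * I) *
        ((∫ y, hermiteFun n y * ((x - y) ^ 2 / ((x - y) ^ 2 + ε ^ 2) / (x - y)) : ℝ) : ℂ) := by
  rw [hermiteCauchy_eq, hermiteCauchy_eq, ← mul_add,
    ← integral_add (integrable_hermiteFun_div n (by simp [hε.ne']))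
      (integrable_hermiteFun_div n (by simp [hε.ne'])),
      ← integral_complex_ofReal, ← integral_const_mul, ← integral_const_mul]
  refine integral_congr_ae (ae_of_all _ fun y => ?_)
  have h1 : (x : ℂ) - I * ε - y ≠ 0 := fun h => hε.ne' (by simpa using congrArg Complex.im h)
  have h2 : (x : ℂ) + I * ε - y ≠ 0 := fun h => hε.ne' (by simpa using congrArg Complex.im h)
  have h3 : ((x : ℂ) - y) ^ 2 + ε ^ 2 = (x - I * ε - y) * (x + I * ε - y) := by
    linear_combination (ε : ℂ) ^ 2 * Complex.I_sq
  have hpi : (Real.pi : ℂ) ≠ 0 := by simp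
  push_cast
  rw [h3, div_right_comm, sq, mul_self_div_self]
  field_simp
  ring

lemma plemelj_sub (n : ℕ) (x : ℝ) :
    Tendsto (fun ε : ℝ => hermiteCauchy n (x - I * ε) - hermiteCauchy n (x + I * ε))
      (𝓝[>] 0) (𝓝 (hermiteFun n x : ℂ)) := by
  obtain ⟨C, -, hC⟩ := exists_abs_hermiteFun_le_const n
  have h := ((tendsto_integral_mul_poisson (continuous_hermiteFun n) hC x).const_mul
    (1 / Real.pi)).ofReal
  rw [← mul_assoc, one_div_mul_cancel Real.pi_ne_zero, one_mul] at h
  refine h.congr' ?_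
  filter_upwards [self_mem_nhdsWithin] with ε hε using (hermiteCauchy_sub n x hε).symm

lemma plemelj_add (n : ℕ) (x : ℝ) :
    ∃ L : ℝ, HasCauchyPV (fun y : ℝ => hermiteFun n y / (x - y)) x L ∧
      Tendsto (fun ε : ℝ => hermiteCauchy n (x - I * ε) + hermiteCauchy n (x + I * ε))
        (𝓝[>] 0) (𝓝 (1 / (Real.pi * I) * (L : ℂ))) := by
  obtain ⟨K, -, hK⟩ := exists_abs_hermiteFun_sub_le n
  have hc := continuous_hermiteFun n
  have hi := integrable_hermiteFun n
  have hset : ∀ δ : ℝ, MeasurableSet {y : ℝ | δ < |y - x|} := fun δ =>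
    measurableSet_lt measurable_const (by fun_prop)
  have hon : ∀ δ : ℝ, 0 < δ →
      IntegrableOn (fun y : ℝ => hermiteFun n y / (x - y)) {y : ℝ | δ < |y - x|} := by
    intro δ hδ
    refine (hi.abs.const_mul δ⁻¹).integrableOn.mono' ?_ ?_
    · exact (Measurable.div (by fun_prop) (by fun_prop)).aestronglyMeasurable
    · filter_upwards [ae_restrict_mem (hset δ)] with y (hy : δ < |y - x|)
      rw [Real.norm_eq_abs, abs_div, abs_sub_comm, div_eq_inv_mul]
      gcongr
  -- the principal value has the factor `1_{δ < |u|}`, the sum of the boundary values the factor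
  -- `u² / (u² + ε²)`, in front of the same kernel `1 / u`
  refine ⟨1 / 2 * ∫ u, (hermiteFun n (x - u) - hermiteFun n (x + u)) / u, ⟨hon, ?_⟩, ?_⟩
  · classical
    have hind : ∀ δ : ℝ, (fun y => hermiteFun n y *
        ((if δ < |x - y| then (1 : ℝ) else 0) / (x - y))) =
        {y : ℝ | δ < |y - x|}.indicator fun y => hermiteFun n y / (x - y) := by
      intro δ
      ext y
      simp only [Set.indicator_apply, Set.mem_ofPred_eq, abs_sub_comm y x]
      split_ifs <;> simp [div_eq_mul_inv]
    have h := tendsto_integral_mul_odd hc hi hK x (κ := fun δ u => if δ < |u| then 1 else 0)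
      (fun δ => Measurable.ite (measurableSet_lt measurable_const (by fun_prop))
        measurable_const measurable_const) (fun δ u => by simp)
      (fun δ u => by split_ifs <;> simp)
      (fun u hu => tendsto_const_nhds.congr' (by
        filter_upwards [nhdsWithin_le_nhds (gt_mem_nhds (abs_pos.2 hu))] with δ hδ
        rw [if_pos hδ]))
      (fun δ hδ => by
        rw [hind, integrable_indicator_iff (hset δ)]
        exact hon δ hδ)
    refine h.congr fun δ => ?_
    rw [hind, integral_indicator (hset δ)]
  · have h := tendsto_integral_mul_odd hc hi hK x (κ := fun ε u => u ^ 2 / (u ^ 2 + ε ^ 2))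
      (fun ε => by fun_prop) (fun ε u => by simp)
      (fun ε u => by
        rw [abs_of_nonneg (by positivity)]
        exact div_le_one_of_le₀ (by nlinarith [sq_nonneg ε]) (by positivity))
      (fun u hu => by
        have : ContinuousAt (fun ε : ℝ => u ^ 2 / (u ^ 2 + ε ^ 2)) 0 :=
          ContinuousAt.div (by fun_prop) (by fun_prop) (by positivity)
        have h2 := this.tendsto.mono_left (nhdsWithin_le_nhds (s := Set.Ioi 0))
        simpa [hu] using h2)
      (fun ε hε => by
        refine (hi.abs.const_mul ε⁻¹).mono' ?_ (ae_of_all _ fun y => ?_)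
        · exact (Measurable.mul (by fun_prop) (by fun_prop)).aestronglyMeasurable
        · rw [Real.norm_eq_abs, abs_mul, mul_comm]
          gcongr
          rw [div_right_comm, sq, mul_self_div_self, abs_div,
            abs_of_pos (a := (x - y) * (x - y) + ε ^ 2) (by
              nlinarith [mul_self_nonneg (x - y), pow_pos hε 2]),
            div_le_iff₀ (by nlinarith [mul_self_nonneg (x - y), pow_pos hε 2]),
            inv_mul_eq_div, le_div_iff₀ hε]
          nlinarith [sq_nonneg (|x - y| - ε), abs_mul_abs_self (x - y), abs_nonneg (x - y)])
    refine (h.ofReal.const_mul (1 / (Real.pi * I))).congr' ?_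
    filter_upwards [self_mem_nhdsWithin] with ε hε using (hermiteCauchy_add n x hε).symm

/-! ### Behaviour at infinity -/

lemma hasDerivAt_exp_cylInt (s : ℂ) (t : ℝ) :
    HasDerivAt (fun t : ℝ => Complex.exp (-(t : ℂ) ^ 2 / 4 - s * t))
      (-(t / 2 + s) * Complex.exp (-(t : ℂ) ^ 2 / 4 - s * t)) t := by
  have h0 : HasDerivAt (fun z : ℂ => -z ^ 2 / 4 - s * z) (-(2 * (t : ℂ)) / 4 - s) (t : ℂ) := by
    exact (((hasDerivAt_pow 2 (t : ℂ)).neg.div_const 4).sub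
      ((hasDerivAt_id (t : ℂ)).const_mul s)).congr_deriv (by simp)
  exact h0.cexp.comp_ofReal.congr_deriv (by ring)

lemma tendsto_cylInt_integrand (n : ℕ) (s : ℂ) :
    Tendsto (fun t : ℝ => (t : ℂ) ^ n * Complex.exp (-(t : ℂ) ^ 2 / 4 - s * t)) atTop (𝓝 0) := by
  have h := tendsto_rpow_mul_exp_neg_mul_atTop_nhds_zero n 1 one_pos
  refine squeeze_zero_norm' ?_ h
  filter_upwards [eventually_ge_atTop 0, eventually_ge_atTop (4 * (1 - s.re))] with t ht0 ht
  rw [norm_mul, norm_exp_cylInt, norm_pow, Complex.norm_real, Real.norm_of_nonneg ht0,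
    Real.rpow_natCast]
  gcongr
  nlinarith

/-- The three-term recurrence of the parabolic cylinder integrals, from an integration by parts.
The boundary term `0 ^ n` is present only for `n = 0`, where the truncated index `n - 1` is harmless
because of the factor `n`. -/
lemma mul_cylInt (n : ℕ) (s : ℂ) :
    s * cylInt n s = 0 ^ n + n * cylInt (n - 1) s - cylInt (n + 1) s / 2 := by
  have h0 := integrableOn_cylInt n s
  have h1 := integrableOn_cylInt (n - 1) s
  have h2 := integrableOn_cylInt (n + 1) s
  have hd : ∀ t : ℝ, HasDerivAt
      (fun t : ℝ => (t : ℂ) ^ n * Complex.exp (-(t : ℂ) ^ 2 / 4 - s * t))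
      (n * ((t : ℂ) ^ (n - 1) * Complex.exp (-(t : ℂ) ^ 2 / 4 - s * t)) -
        (1 / 2 * ((t : ℂ) ^ (n + 1) * Complex.exp (-(t : ℂ) ^ 2 / 4 - s * t)) +
        s * ((t : ℂ) ^ n * Complex.exp (-(t : ℂ) ^ 2 / 4 - s * t)))) t := fun t =>
    (((hasDerivAt_pow n (t : ℂ)).comp_ofReal).mul (hasDerivAt_exp_cylInt s t)).congr_deriv
      (by ring)
  have h := integral_Ioi_of_hasDerivAt_of_tendsto (hd 0).continuousAt.continuousWithinAt
    (fun t _ => hd t) ((h1.const_mul (n : ℂ)).sub ((h2.const_mul (1 / 2)).add (h0.const_mul s)))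
    (tendsto_cylInt_integrand n s)
  have h3 : IntegrableOn (fun t : ℝ =>
      1 / 2 * ((t : ℂ) ^ (n + 1) * Complex.exp (-(t : ℂ) ^ 2 / 4 - s * t)) +
        s * ((t : ℂ) ^ n * Complex.exp (-(t : ℂ) ^ 2 / 4 - s * t))) (Set.Ioi 0) :=
    (h2.const_mul (1 / 2)).add (h0.const_mul s)
  rw [integral_sub (h1.const_mul (n : ℂ)) h3,
    integral_add (h2.const_mul (1 / 2)) (h0.const_mul s), integral_const_mul, integral_const_mul,
    integral_const_mul] at h
  change n * cylInt (n - 1) s - (1 / 2 * cylInt (n + 1) s + s * cylInt n s) = _ at h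
  simp only [Complex.ofReal_zero, mul_zero] at h
  norm_num at h
  linear_combination -h

lemma exists_norm_cylInt_le (n : ℕ) : ∃ C, ∀ s : ℂ, 0 ≤ s.re → ‖cylInt n s‖ ≤ C := by
  refine ⟨∫ t : ℝ in Set.Ioi 0, t ^ n * Real.exp (-t ^ 2 / 4 - 0 * t), fun s hs => ?_⟩
  refine norm_integral_le_of_norm_le (integrableOn_pow_mul_exp n 0) ?_
  filter_upwards [ae_restrict_mem measurableSet_Ioi] with t (ht : 0 < t)
  rw [norm_mul, norm_exp_cylInt, norm_pow, Complex.norm_real, Real.norm_of_nonneg ht.le]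
  gcongr

/-- `J_n(s) = O(s^{-k})` for `k ≤ n + 1`, uniformly in the closed right half plane: the
recurrence trades one power of `s` for the neighbouring orders. -/
lemma exists_pow_mul_norm_cylInt_le (k n : ℕ) (hk : k ≤ n + 1) :
    ∃ C, ∀ s : ℂ, 0 ≤ s.re → ‖s‖ ^ k * ‖cylInt n s‖ ≤ C := by
  induction k generalizing n with
  | zero => simpa using exists_norm_cylInt_le n
  | succ k ih =>
    obtain ⟨C₂, h₂⟩ := ih (n + 1) (by omega)
    cases n with
    | zero =>
      obtain rfl : k = 0 := by omega
      refine ⟨1 + C₂ / 2, fun s hs => ?_⟩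
      have h := mul_cylInt 0 s
      have h2 := h₂ s hs
      rw [zero_add, pow_one, ← norm_mul, h]
      simp only [pow_zero, CharP.cast_eq_zero, zero_mul, add_zero, zero_add, one_mul] at h2 ⊢
      refine (norm_sub_le _ _).trans ?_
      rw [norm_one, norm_div, Complex.norm_ofNat]
      gcongr
    | succ m =>
      obtain ⟨C₁, h₁⟩ := ih m (by omega)
      refine ⟨(m + 1) * C₁ + C₂ / 2, fun s hs => ?_⟩
      have h := mul_cylInt (m + 1) s
      simp only [ne_eq, Nat.add_eq_zero_iff, one_ne_zero, and_false, not_false_eq_true, zero_pow,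
        zero_add, add_tsub_cancel_right] at h
      rw [pow_succ, mul_assoc, ← norm_mul, h]
      have h3 : ‖((m + 1 : ℕ) : ℂ)‖ = m + 1 := by
        rw [Complex.norm_natCast]; push_cast; rfl
      calc _ ≤ ‖s‖ ^ k * ((m + 1) * ‖cylInt m s‖ + ‖cylInt (m + 1 + 1) s‖ / 2) := by
            gcongr
            refine (norm_sub_le _ _).trans ?_
            rw [norm_div, norm_mul, h3, Complex.norm_ofNat]
        _ = (m + 1) * (‖s‖ ^ k * ‖cylInt m s‖) + ‖s‖ ^ k * ‖cylInt (m + 1 + 1) s‖ / 2 := by ring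
        _ ≤ _ := by gcongr <;> [exact h₁ s hs; exact h₂ s hs]

/-- The leading term `n! / s^(n+1)` satisfies the recurrence without its last term, so the
difference inherits the decay of `J_{n+1}`. -/
lemma exists_pow_mul_norm_cylInt_sub_le (n : ℕ) :
    ∃ C, ∀ s : ℂ, 0 ≤ s.re → s ≠ 0 →
      ‖s‖ ^ (n + 2) * ‖cylInt n s - n.factorial / s ^ (n + 1)‖ ≤ C := by
  induction n with
  | zero =>
    obtain ⟨C, hC⟩ := exists_pow_mul_norm_cylInt_le 1 1 (by omega)
    refine ⟨C / 2, fun s hs h0 => ?_⟩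
    have h : s * (cylInt 0 s - (Nat.factorial 0 : ℂ) / s ^ (0 + 1)) = -(cylInt 1 s / 2) := by
      rw [mul_sub, mul_cylInt]
      simp [h0]
    rw [zero_add, sq, mul_assoc, ← norm_mul, h, norm_neg, norm_div, Complex.norm_ofNat,
      ← mul_div_assoc]
    have := hC s hs
    rw [pow_one] at this
    gcongr
  | succ n ih =>
    obtain ⟨C₁, h₁⟩ := ih
    obtain ⟨C₂, h₂⟩ := exists_pow_mul_norm_cylInt_le (n + 2) (n + 2) (by omega)
    refine ⟨(n + 1) * C₁ + C₂ / 2, fun s hs h0 => ?_⟩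
    have h : s * (cylInt (n + 1) s - (Nat.factorial (n + 1) : ℂ) / s ^ (n + 1 + 1)) =
        ((n + 1 : ℕ) : ℂ) * (cylInt n s - n.factorial / s ^ (n + 1)) -
          cylInt (n + 1 + 1) s / 2 := by
      rw [mul_sub, mul_cylInt, Nat.factorial_succ]
      simp
      field_simp
      ring
    have h3 : ‖((n + 1 : ℕ) : ℂ)‖ = n + 1 := by
      rw [Complex.norm_natCast]; push_cast; rfl
    rw [show n + 1 + 2 = (n + 2) + 1 by ring, pow_succ, mul_assoc, ← norm_mul, h]
    calc _ ≤ ‖s‖ ^ (n + 2) * ((n + 1) * ‖cylInt n s - n.factorial / s ^ (n + 1)‖ +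
            ‖cylInt (n + 2) s‖ / 2) := by
          gcongr
          refine (norm_sub_le _ _).trans ?_
          rw [norm_div, norm_mul, h3, Complex.norm_ofNat]
      _ = (n + 1) * (‖s‖ ^ (n + 2) * ‖cylInt n s - n.factorial / s ^ (n + 1)‖) +
          ‖s‖ ^ (n + 2) * ‖cylInt (n + 2) s‖ / 2 := by ring
      _ ≤ _ := by gcongr <;> [exact h₁ s hs h0; exact h₂ s hs]

lemma exists_pow_mul_norm_hermiteCauchy_sub_le (n : ℕ) :
    ∃ C, ∀ z : ℂ, z.im ≠ 0 → ‖z‖ ^ (n + 2) * ‖hermiteCauchy n z -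
      n.factorial / (2 * (Real.sqrt Real.pi : ℂ) * I * z ^ (n + 1))‖ ≤ C := by
  obtain ⟨C, hC⟩ := exists_pow_mul_norm_cylInt_sub_le n
  have hpos : 0 < Real.sqrt Real.pi := Real.sqrt_pos.2 Real.pi_pos
  have hs : (Real.sqrt Real.pi : ℂ) ≠ 0 := by simpa using hpos.ne'
  have key : ∀ z : ℂ, 0 < z.im → ‖z‖ ^ (n + 2) * ‖hermiteCauchy n z -
      n.factorial / (2 * (Real.sqrt Real.pi : ℂ) * I * z ^ (n + 1))‖ ≤
        C / (2 * Real.sqrt Real.pi) := by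
    intro z hz
    have h0 : z ≠ 0 := fun h => by simp [h] at hz
    have h1 := hC (-I * z) (by simpa using hz.le) (by simp [h0])
    have h2 : hermiteCauchy n z - n.factorial / (2 * (Real.sqrt Real.pi : ℂ) * I * z ^ (n + 1)) =
        -(-I) ^ n / (2 * Real.sqrt Real.pi) *
          (cylInt n (-I * z) - n.factorial / (-I * z) ^ (n + 1)) := by
      rw [hermiteCauchy_of_im_pos n hz, mul_sub, mul_pow, pow_succ (-I)]
      have hI : (-I) ^ n ≠ 0 := pow_ne_zero _ (by simp)
      congr 1
      field_simp
    rw [norm_mul, norm_neg, Complex.norm_I, one_mul] at h1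
    rw [h2, norm_mul, norm_div, norm_neg, norm_pow, norm_neg, Complex.norm_I, one_pow, norm_mul,
      Complex.norm_ofNat, Complex.norm_real, Real.norm_of_nonneg hpos.le, one_div_mul_eq_div,
      ← mul_div_assoc]
    gcongr
  refine ⟨C / (2 * Real.sqrt Real.pi), fun z hz => ?_⟩
  rcases hz.lt_or_gt with h | h
  · have h1 := key (-z) (by simpa using h)
    rw [hermiteCauchy_neg, neg_pow z, norm_neg] at h1
    have h2 : (-1 : ℂ) ^ (n + 1) * hermiteCauchy n z -
        n.factorial / (2 * (Real.sqrt Real.pi : ℂ) * I * ((-1) ^ (n + 1) * z ^ (n + 1))) =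
        (-1 : ℂ) ^ (n + 1) * (hermiteCauchy n z -
          n.factorial / (2 * (Real.sqrt Real.pi : ℂ) * I * z ^ (n + 1))) := by
      rcases neg_one_pow_eq_or ℂ (n + 1) with h | h <;> rw [h] <;> ring
    rwa [h2, norm_mul, norm_pow, norm_neg, norm_one, one_pow, one_mul] at h1
  · exact key z h

lemma hermiteCauchy_sub_isBigO (n : ℕ) :
    (fun z : ℂ => hermiteCauchy n z -
        (n.factorial : ℂ) / (2 * (Real.sqrt Real.pi : ℂ) * I * z ^ (n + 1)))
      =O[Bornology.cobounded ℂ ⊓ 𝓟 {z : ℂ | z.im ≠ 0}] (fun z : ℂ => (z ^ (n + 2))⁻¹) := by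
  obtain ⟨C, hC⟩ := exists_pow_mul_norm_hermiteCauchy_sub_le n
  refine IsBigO.of_bound C ?_
  filter_upwards [mem_inf_of_right (mem_principal_self _)] with z (hz : z.im ≠ 0)
  have h0 : z ≠ 0 := fun h => by simp [h] at hz
  rw [norm_inv, norm_pow, ← div_eq_mul_inv, le_div_iff₀ (by positivity), mul_comm]
  exact hC z hz

/-! ### Kummer's function -/

/-- The duplication formula at half-integers. -/
lemma Gamma_half_mul_Gamma_half (m : ℕ) :
    Real.Gamma ((m + 1) / 2) * Real.Gamma ((m + 1) / 2 + 1 / 2) * 2 ^ m =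
      m.factorial * Real.sqrt Real.pi := by
  rw [Real.Gamma_mul_Gamma_add_half, show 2 * (((m : ℝ) + 1) / 2) = m + 1 by ring,
    Real.Gamma_nat_eq_factorial, show (1 : ℝ) - (m + 1) = -m by ring,
    Real.rpow_neg zero_le_two, Real.rpow_natCast]
  field_simp

lemma integral_pow_mul_exp_neg_sq (m : ℕ) :
    ∫ t : ℝ in Set.Ioi 0, t ^ m * Real.exp (-t ^ 2 / 4) = 2 ^ m * Real.Gamma ((m + 1) / 2) := by
  have h := integral_rpow_mul_exp_neg_mul_rpow (p := 2) (q := m) (b := 1 / 4) two_pos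
    (by linarith [(Nat.cast_nonneg m : (0 : ℝ) ≤ m)]) (by norm_num)
  have e : ((1 : ℝ) / 4) ^ (-((m : ℝ) + 1) / 2) = 2 ^ (m + 1) := by
    rw [show (1 : ℝ) / 4 = 2 ^ (-2 : ℝ) by rw [Real.rpow_neg zero_le_two]; norm_num,
      ← Real.rpow_mul zero_le_two, ← Real.rpow_natCast]
    congr 1
    push_cast
    ring
  rw [e] at h
  convert h using 1
  · refine integral_congr_ae (ae_of_all _ fun t => ?_)
    simp only [Real.rpow_natCast, Real.rpow_ofNat]
    ring_nf
  · ring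

/-- The power series of the parabolic cylinder integral, by expanding `exp (-s t)` and integrating
term by term. -/
lemma hasSum_cylInt (n : ℕ) (s : ℂ) :
    HasSum (fun k : ℕ => (-s) ^ k / k.factorial *
      ((2 ^ (n + k) * Real.Gamma (((n + k : ℕ) + 1) / 2) : ℝ) : ℂ)) (cylInt n s) := by
  have hb : ∀ t : ℝ, HasSum (fun k : ℕ => t ^ n * Real.exp (-t ^ 2 / 4) *
      ((‖s‖ * t) ^ k / k.factorial)) (t ^ n * Real.exp (-t ^ 2 / 4 - -‖s‖ * t)) := by
    intro t
    have h := (NormedSpace.expSeries_div_hasSum_exp (‖s‖ * t)).mul_left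
      (t ^ n * Real.exp (-t ^ 2 / 4))
    rwa [← Real.exp_eq_exp_ℝ, mul_assoc, ← Real.exp_add, ← sub_neg_eq_add, ← neg_mul] at h
  have hi := integrableOn_pow_mul_exp n (-‖s‖)
  have h := hasSum_integral_of_dominated_convergence (μ := volume.restrict (Set.Ioi 0))
    (F := fun (k : ℕ) (t : ℝ) => (t : ℂ) ^ n * Complex.exp (-t ^ 2 / 4) *
      ((-s * t) ^ k / k.factorial))
    (f := fun t : ℝ => (t : ℂ) ^ n * Complex.exp (-t ^ 2 / 4 - s * t))
    (fun (k : ℕ) (t : ℝ) => t ^ n * Real.exp (-t ^ 2 / 4) * ((‖s‖ * t) ^ k / k.factorial))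
    (fun k => by fun_prop)
    (fun k => by
      filter_upwards [ae_restrict_mem measurableSet_Ioi] with t (ht : 0 < t)
      have h1 := norm_exp_cylInt 0 t
      simp only [zero_mul, sub_zero, Complex.zero_re] at h1
      rw [norm_mul, norm_mul, h1, norm_pow, norm_div, norm_pow, norm_mul, norm_neg,
        Complex.norm_real, Real.norm_of_nonneg ht.le, Complex.norm_natCast])
    (ae_of_all _ fun t => (hb t).summable)
    (hi.congr (ae_of_all _ fun t => (hb t).tsum_eq.symm))
    (ae_of_all _ fun t => by
      have h := (NormedSpace.expSeries_div_hasSum_exp (-s * (t : ℂ))).mul_left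
        ((t : ℂ) ^ n * Complex.exp (-t ^ 2 / 4))
      rwa [← Complex.exp_eq_exp_ℂ, mul_assoc, ← Complex.exp_add,
        neg_mul, ← sub_eq_add_neg, ← neg_mul] at h)
  refine h.congr_fun fun k => ?_
  rw [← integral_pow_mul_exp_neg_sq, ← integral_complex_ofReal, ← integral_const_mul]
  refine integral_congr_ae (ae_of_all _ fun t => ?_)
  push_cast
  ring

lemma regularizedHGFun_eq_tsum (a b z : ℂ) :
    Complex.regularizedHGFun {a} {b} z = ∑' k : ℕ,
      (ascPochhammer ℂ k).eval a / (k.factorial * Complex.Gamma (b + k)) * z ^ k := by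
  rw [Complex.regularizedHGFun, Complex.regularizedHGFunSeries]
  have := FormalMultilinearSeries.ofScalars_sum_eq (E := ℂ)
    (Complex.regularizedHGFunCoeff {a} {b}) z
  rw [FormalMultilinearSeries.ofScalarsSum] at this
  rw [this]
  simp [Complex.regularizedHGFunCoeff]

lemma Gamma_half_mul_Gamma_half_complex (m : ℕ) :
    Complex.Gamma ((m + 1) / 2) * Complex.Gamma ((m + 1) / 2 + 1 / 2) * 2 ^ m =
      m.factorial * Real.sqrt Real.pi := by
  have h := congrArg (Complex.ofReal) (Gamma_half_mul_Gamma_half m)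
  push_cast at h
  rw [← Complex.Gamma_ofReal, ← Complex.Gamma_ofReal] at h
  push_cast at h
  exact h

lemma Gamma_mul_ascPochhammer {a : ℂ} (ha : 0 < a.re) (j : ℕ) :
    Complex.Gamma a * (ascPochhammer ℂ j).eval a = Complex.Gamma (a + j) := by
  rw [← Complex.Gamma_add_nat_div_Gamma_eq, mul_div_cancel₀ _ (Complex.Gamma_ne_zero_of_re_pos ha)]
  rintro k rfl
  simp at ha
  linarith [(Nat.cast_nonneg k : (0 : ℝ) ≤ k)]

/-- The even part of the power series is a multiple of the first Kummer function in `U`. -/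
lemma cylInt_coeff_even (n j : ℕ) (s : ℂ) :
    (-s) ^ (2 * j) / (2 * j).factorial *
        ((2 ^ (n + 2 * j) * Real.Gamma (((n + 2 * j : ℕ) + 1) / 2) : ℝ) : ℂ) =
      2 ^ n * Real.sqrt Real.pi * Complex.Gamma ((n + 1) / 2) *
        ((ascPochhammer ℂ j).eval (((n : ℂ) + 1) / 2) /
          (j.factorial * Complex.Gamma (1 / 2 + j)) * (s ^ 2) ^ j) := by
  have ha : 0 < (((n : ℂ) + 1) / 2).re := by
    rw [show ((n : ℂ) + 1) / 2 = (((n + 1) / 2 : ℝ) : ℂ) by push_cast; ring, Complex.ofReal_re]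
    positivity
  have h1 := Gamma_mul_ascPochhammer ha j
  have h2 := Gamma_half_mul_Gamma_half_complex (2 * j)
  rw [show (((2 * j : ℕ) : ℂ) + 1) / 2 + 1 / 2 = j + 1 by push_cast; ring,
    show (((2 * j : ℕ) : ℂ) + 1) / 2 = 1 / 2 + j by push_cast; ring,
    Complex.Gamma_nat_eq_factorial] at h2
  have h3 : Complex.Gamma (1 / 2 + j) ≠ 0 := by
    apply Complex.Gamma_ne_zero_of_re_pos
    simp
    positivity
  have h4 : ((2 * j).factorial : ℂ) ≠ 0 := by exact_mod_cast (2 * j).factorial_ne_zero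
  have h5 : (j.factorial : ℂ) ≠ 0 := by exact_mod_cast j.factorial_ne_zero
  push_cast
  rw [← Complex.Gamma_ofReal,
    show (((((n : ℝ) + 2 * j + 1) / 2 : ℝ)) : ℂ) = (n + 1) / 2 + j by push_cast; ring, ← h1,
    pow_mul, neg_sq, pow_add]
  have h6 : (2 : ℂ) ^ (2 * j) / (2 * j).factorial =
      Real.sqrt Real.pi / (j.factorial * Complex.Gamma (1 / 2 + j)) := by
    rw [div_eq_div_iff h4 (mul_ne_zero h5 h3)]
    linear_combination h2
  generalize Complex.Gamma (1 / 2 + j) = A at h6 ⊢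
  generalize (ascPochhammer ℂ j).eval (((n : ℂ) + 1) / 2) = P
  generalize Complex.Gamma ((n + 1) / 2) = B
  linear_combination ((s ^ 2) ^ j * 2 ^ n * B * P) * h6

/-- The odd part of the power series is a multiple of the second Kummer function in `U`. -/
lemma cylInt_coeff_odd (n j : ℕ) (s : ℂ) :
    (-s) ^ (2 * j + 1) / (2 * j + 1).factorial *
        ((2 ^ (n + (2 * j + 1)) * Real.Gamma (((n + (2 * j + 1) : ℕ) + 1) / 2) : ℝ) : ℂ) =
      -s * 2 ^ n * Real.sqrt Real.pi * Complex.Gamma ((n + 1) / 2 + 1 / 2) *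
        ((ascPochhammer ℂ j).eval (((n : ℂ) + 1) / 2 + 1 / 2) /
          (j.factorial * Complex.Gamma (3 / 2 + j)) * (s ^ 2) ^ j) := by
  have ha : 0 < (((n : ℂ) + 1) / 2 + 1 / 2).re := by
    rw [show ((n : ℂ) + 1) / 2 + 1 / 2 = (((n + 1) / 2 + 1 / 2 : ℝ) : ℂ) by push_cast; ring,
      Complex.ofReal_re]
    positivity
  have h1 := Gamma_mul_ascPochhammer ha j
  have h2 := Gamma_half_mul_Gamma_half_complex (2 * j + 1)
  rw [show (((2 * j + 1 : ℕ) : ℂ) + 1) / 2 + 1 / 2 = 3 / 2 + j by push_cast; ring,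
    show (((2 * j + 1 : ℕ) : ℂ) + 1) / 2 = j + 1 by push_cast; ring,
    Complex.Gamma_nat_eq_factorial] at h2
  have h3 : Complex.Gamma (3 / 2 + j) ≠ 0 := by
    apply Complex.Gamma_ne_zero_of_re_pos
    rw [show (3 / 2 + (j : ℂ)) = ((3 / 2 + j : ℝ) : ℂ) by push_cast; ring, Complex.ofReal_re]
    positivity
  have h4 : ((2 * j + 1).factorial : ℂ) ≠ 0 := by exact_mod_cast (2 * j + 1).factorial_ne_zero
  have h5 : (j.factorial : ℂ) ≠ 0 := by exact_mod_cast j.factorial_ne_zero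
  push_cast
  rw [← Complex.Gamma_ofReal,
    show (((((n : ℝ) + (2 * j + 1) + 1) / 2 : ℝ)) : ℂ) = (n + 1) / 2 + 1 / 2 + j by
      push_cast; ring, ← h1, pow_succ, pow_mul, neg_sq, pow_add]
  have h6 : (2 : ℂ) ^ (2 * j + 1) / (2 * j + 1).factorial =
      Real.sqrt Real.pi / (j.factorial * Complex.Gamma (3 / 2 + j)) := by
    rw [div_eq_div_iff h4 (mul_ne_zero h5 h3)]
    linear_combination h2
  generalize Complex.Gamma (3 / 2 + j) = A at h6 ⊢
  generalize (ascPochhammer ℂ j).eval (((n : ℂ) + 1) / 2 + 1 / 2) = P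
  generalize Complex.Gamma ((n + 1) / 2 + 1 / 2) = B
  linear_combination (-((s ^ 2) ^ j * s * 2 ^ n * B * P)) * h6

lemma kummerU_half (a w : ℂ) : kummerU a (1 / 2) w = kummerUComb a (1 / 2) w := by
  refine if_neg ?_
  rintro ⟨m, hm⟩
  have h : (1 : ℂ) = 2 * m := by linear_combination 2 * hm
  norm_cast at h
  omega

/-- For `0 < re s` the principal branch gives `(s²)^(1/2) = s`. -/
lemma cylInt_eq_kummerU (n : ℕ) {s : ℂ} (hs : 0 < s.re) :
    cylInt n s = n.factorial * kummerU ((n + 1) / 2) (1 / 2) (s ^ 2) := by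
  obtain ⟨T, hT⟩ : ∃ T : ℕ → ℂ, ∀ k, T k = (-s) ^ k / k.factorial *
    ((2 ^ (n + k) * Real.Gamma (((n + k : ℕ) + 1) / 2) : ℝ) : ℂ) := ⟨_, fun _ => rfl⟩
  have hsum : HasSum T (cylInt n s) := (funext hT : T = _) ▸ hasSum_cylInt n s
  have he : Summable fun j => T (2 * j) := hsum.summable.comp_injective (fun a b h => by
    simpa using h)
  have ho : Summable fun j => T (2 * j + 1) := hsum.summable.comp_injective (fun a b h => by
    simpa using h)
  have h := tsum_even_add_odd he ho
  simp_rw [hsum.tsum_eq, hT, cylInt_coeff_even, cylInt_coeff_odd, tsum_mul_left,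
    ← regularizedHGFun_eq_tsum] at h
  -- duplication turns `n! π / Γ(a + 1/2)` into `2^n √π Γ(a)`, where `a = (n + 1) / 2`
  have hd := Gamma_half_mul_Gamma_half_complex n
  have h1 : Complex.Gamma ((n + 1) / 2) ≠ 0 := by
    apply Complex.Gamma_ne_zero_of_re_pos
    rw [show ((n : ℂ) + 1) / 2 = (((n + 1) / 2 : ℝ) : ℂ) by push_cast; ring, Complex.ofReal_re]
    positivity
  have h2 : Complex.Gamma ((n + 1) / 2 + 1 / 2) ≠ 0 := by
    apply Complex.Gamma_ne_zero_of_re_pos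
    rw [show ((n : ℂ) + 1) / 2 + 1 / 2 = (((n + 1) / 2 + 1 / 2 : ℝ) : ℂ) by push_cast; ring,
      Complex.ofReal_re]
    positivity
  have hpi : (Real.pi : ℂ) = (Real.sqrt Real.pi : ℂ) ^ 2 := by
    rw [← Complex.ofReal_pow, Real.sq_sqrt Real.pi_pos.le]
  rw [kummerU_half, kummerUComb,
    show (Real.pi : ℂ) * (1 / 2) = Real.pi / 2 by ring, Complex.sin_pi_div_two, div_one,
    show (1 : ℂ) - 1 / 2 = 2⁻¹ by norm_num, Complex.sq_cpow_two_inv hs,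
    show ((n : ℂ) + 1) / 2 - 1 / 2 + 1 = (n + 1) / 2 + 1 / 2 by ring,
    show (2 : ℂ) - 1 / 2 = 3 / 2 by norm_num, ← h, hpi]
  generalize Complex.regularizedHGFun {((n : ℂ) + 1) / 2} {1 / 2} (s ^ 2) = M
  generalize Complex.regularizedHGFun {((n : ℂ) + 1) / 2 + 1 / 2} {3 / 2} (s ^ 2) = N
  generalize Complex.Gamma ((n + 1) / 2) = A at h1 hd ⊢
  generalize Complex.Gamma ((n + 1) / 2 + 1 / 2) = B at h2 hd ⊢
  field_simp
  linear_combination (A * M - B * s * N) * hd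

lemma exp_neg_nat_mul_pi (n : ℕ) :
    Complex.exp (-((n : ℂ) + 2) * Real.pi * I / 2) = -(-I) ^ n := by
  rw [show -((n : ℂ) + 2) * Real.pi * I / 2 = n * (-(Real.pi / 2) * I) + -(Real.pi * I) by ring,
    Complex.exp_add, Complex.exp_nat_mul, Complex.exp_neg, Complex.exp_pi_mul_I, neg_mul,
    Complex.exp_neg, Complex.exp_pi_div_two_mul_I, Complex.inv_I]
  ring

lemma hermiteCauchy_eq_kummerU_of_im_pos (n : ℕ) {z : ℂ} (hz : 0 < z.im) :
    hermiteCauchy n z = Complex.Gamma ((n : ℂ) + 1) / (2 * (Real.sqrt Real.pi : ℂ)) *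
      kummerU (((n : ℂ) + 1) / 2) (1 / 2) (-z ^ 2) *
      Complex.exp (-((n : ℂ) + 2) * (Real.pi : ℂ) * I / 2) := by
  rw [exp_neg_nat_mul_pi, hermiteCauchy_of_im_pos n hz,
    cylInt_eq_kummerU n (s := -I * z) (by simpa using hz), Complex.Gamma_nat_eq_factorial, mul_pow,
    neg_sq, Complex.I_sq, neg_one_mul]
  ring

lemma hermiteCauchy_eq_kummerU_of_im_neg (n : ℕ) {z : ℂ} (hz : z.im < 0) :
    hermiteCauchy n z = Complex.Gamma ((n : ℂ) + 1) / (2 * (Real.sqrt Real.pi : ℂ)) *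
      kummerU (((n : ℂ) + 1) / 2) (1 / 2) (-z ^ 2) *
      Complex.exp ((n : ℂ) * (Real.pi : ℂ) * I / 2) := by
  have h := hermiteCauchy_neg n (-z)
  rw [neg_neg, hermiteCauchy_eq_kummerU_of_im_pos n (z := -z) (by simpa using hz), neg_sq,
    exp_neg_nat_mul_pi] at h
  rw [h, show (n : ℂ) * Real.pi * I / 2 = n * (Real.pi / 2 * I) by ring, Complex.exp_nat_mul,
    Complex.exp_pi_div_two_mul_I, neg_pow I]
  have : (-1 : ℂ) ^ (n + 1) * -((-1) ^ n) = 1 := by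
    rw [pow_succ]
    have : (-1 : ℂ) ^ n * (-1) ^ n = 1 := by rw [← mul_pow]; simp
    linear_combination this
  linear_combination (Complex.Gamma ((n : ℂ) + 1) / (2 * (Real.sqrt Real.pi : ℂ)) *
      kummerU (((n : ℂ) + 1) / 2) (1 / 2) (-z ^ 2) * I ^ n) * this

/-! ### Behaviour for large degree -/

/-- The integrand `t^n exp (-t²/4)` recentred at its maximum `t = √(2n)` and normalized to the value
`1` there; it is `0` where `t = √(2n) + u` is not positive. -/
noncomputable def peak (n : ℕ) (u : ℝ) : ℝ :=
  if 0 < √(2 * n) + u then (1 + u / √(2 * n)) ^ n * Real.exp (-√(2 * n) * u / 2 - u ^ 2 / 4) else 0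

lemma measurable_peak (n : ℕ) : Measurable (peak n) :=
  Measurable.ite (measurableSet_lt measurable_const (by fun_prop)) (by fun_prop) measurable_const

lemma abs_exp_sub_exp_le {p q m : ℝ} (hp : p ≤ m) (hq : q ≤ m) :
    |Real.exp p - Real.exp q| ≤ |p - q| * Real.exp m := by
  wlog h : q ≤ p generalizing p q
  · rw [abs_sub_comm, abs_sub_comm p]
    exact this hq hp (le_of_not_ge h)
  rw [abs_of_nonneg (sub_nonneg.2 (Real.exp_le_exp.2 h)), abs_of_nonneg (sub_nonneg.2 h)]
  have h1 : Real.exp p * (1 - Real.exp (q - p)) = Real.exp p - Real.exp q := by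
    rw [mul_sub, ← Real.exp_add]; ring_nf
  have h2 := Real.add_one_le_exp (q - p)
  calc _ = Real.exp p * (1 - Real.exp (q - p)) := h1.symm
    _ ≤ Real.exp p * (p - q) := mul_le_mul_of_nonneg_left (by linarith) (Real.exp_pos p).le
    _ ≤ Real.exp m * (p - q) := by gcongr
    _ = _ := mul_comm _ _

lemma peak_nonneg (n : ℕ) (u : ℝ) : 0 ≤ peak n u := by
  unfold peak
  split_ifs with h
  · rcases (Real.sqrt_nonneg (2 * n)).eq_or_lt with h0 | h0
    · rw [← h0]; simp; positivity
    · have : 0 ≤ 1 + u / √(2 * n) := by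
        rw [show 1 + u / √(2 * n) = (√(2 * n) + u) / √(2 * n) by field_simp]
        positivity
      positivity
  · rfl

lemma peak_le (n : ℕ) (hn : n ≠ 0) (u : ℝ) : peak n u ≤ Real.exp (-u ^ 2 / 4) := by
  have hT : 0 < √(2 * n) := Real.sqrt_pos.2 (by positivity)
  have hT2 : √(2 * n) ^ 2 = 2 * n := Real.sq_sqrt (by positivity)
  unfold peak
  split_ifs with h
  · have h1 : 0 ≤ 1 + u / √(2 * n) := by
      rw [show 1 + u / √(2 * n) = (√(2 * n) + u) / √(2 * n) by field_simp]
      positivity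
    -- `1 + x ≤ exp x` with `x = u / √(2n)`, whose `n`-th power cancels the linear term
    calc _ ≤ Real.exp (u / √(2 * n)) ^ n * Real.exp (-√(2 * n) * u / 2 - u ^ 2 / 4) := by
          gcongr
          linarith [Real.add_one_le_exp (u / √(2 * n))]
      _ = _ := by
        rw [← Real.exp_nat_mul, ← Real.exp_add]
        congr 1
        have : (n : ℝ) * (u / √(2 * n)) = √(2 * n) * u / 2 := by
          rw [← mul_div_assoc, div_eq_iff hT.ne']
          linear_combination -u / 2 * hT2
        rw [this]
        ring
  · positivity

/-- The recentred integrand is a Gaussian up to a relative error of order `|u|³ / √n`, with half of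
the Gaussian decay to spare. -/
lemma abs_peak_sub_le (n : ℕ) (hn : n ≠ 0) (u : ℝ) :
    |peak n u - Real.exp (-u ^ 2 / 2)| ≤
      8 / √(2 * n) * (|u| ^ 3 * Real.exp (-u ^ 2 / 4)) := by
  have hn1 : (1 : ℝ) ≤ n := by exact_mod_cast Nat.one_le_iff_ne_zero.2 hn
  have hT : 0 < √(2 * n) := Real.sqrt_pos.2 (by positivity)
  have hT1 : 1 ≤ √(2 * n) := Real.one_le_sqrt.2 (by linarith)
  have hT2 : √(2 * n) ^ 2 = 2 * n := Real.sq_sqrt (by positivity)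
  have hE : Real.exp (-u ^ 2 / 2) ≤ Real.exp (-u ^ 2 / 4) :=
    Real.exp_le_exp.2 (by nlinarith [sq_nonneg u])
  have hP := peak_le n hn u
  rcases le_or_gt (√(2 * n) / 2) |u| with hu | hu
  -- far from the peak both terms lie below `exp (-u²/4)`, and `1 ≤ (2 |u| / √(2n))³`
  · have h1 : |peak n u - Real.exp (-u ^ 2 / 2)| ≤ Real.exp (-u ^ 2 / 4) := by
      rw [abs_le]
      constructor <;> linarith [peak_nonneg n u, Real.exp_pos (-u ^ 2 / 2)]
    refine h1.trans ?_
    rw [← mul_assoc]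
    refine le_mul_of_one_le_left (Real.exp_pos _).le ?_
    rw [div_mul_eq_mul_div, le_div_iff₀ hT, one_mul]
    calc √(2 * n) ≤ √(2 * n) ^ 3 := le_self_pow₀ hT1 (by norm_num)
      _ ≤ (2 * |u|) ^ 3 := by gcongr; linarith
      _ = _ := by ring
  -- near the peak the exponents are compared by the Taylor expansion of the logarithm
  · generalize hTdef : √(2 * n) = T at *
    have hx : |u / T| < 1 / 2 := by
      rw [abs_div, abs_of_pos hT, div_lt_iff₀ hT]; linarith
    have h0 : 0 < 1 + u / T := by linarith [(abs_lt.1 hx).1]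
    have hpos : 0 < T + u := by
      rw [show T + u = T * (1 + u / T) by field_simp]; positivity
    have hpk : peak n u = Real.exp (n * Real.log (1 + u / T) + (-T * u / 2 - u ^ 2 / 4)) := by
      rw [peak, hTdef, if_pos hpos, Real.exp_add, Real.exp_nat_mul, Real.exp_log h0]
    have hlog := Real.abs_log_sub_add_sum_range_le (x := -(u / T)) (by rw [abs_neg]; linarith) 2
    simp only [Finset.sum_range_succ, Finset.sum_range_zero] at hlog
    norm_num at hlog
    rw [hpk] at hP ⊢
    have h2 := abs_exp_sub_exp_le (Real.exp_le_exp.1 hP) (Real.exp_le_exp.1 hE)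
    refine h2.trans ?_
    rw [← mul_assoc]
    gcongr
    have h3 : n * Real.log (1 + u / T) + (-T * u / 2 - u ^ 2 / 4) - -u ^ 2 / 2 =
        n * (-(u / T) + (u / T) ^ 2 / 2 + Real.log (1 + u / T)) := by
      have hn' : (n : ℝ) = T ^ 2 / 2 := by linarith
      rw [hn']
      field_simp
      ring
    rw [h3, abs_mul, abs_of_pos (by linarith : (0 : ℝ) < n)]
    have h4 : |u / T| ^ 3 / (1 - |u / T|) ≤ 2 * |u / T| ^ 3 := by
      rw [div_le_iff₀ (by linarith)]
      nlinarith [pow_nonneg (abs_nonneg (u / T)) 3]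
    have h5 : |-(u / T) + (u / T) ^ 2 / 2 + Real.log (1 + u / T)| ≤ 2 * |u / T| ^ 3 :=
      le_trans (by simpa [abs_div] using hlog) h4
    calc _ ≤ n * (2 * |u / T| ^ 3) := by gcongr
      _ = 1 / T * |u| ^ 3 := by
        have hn' : (n : ℝ) = T ^ 2 / 2 := by linarith
        rw [hn', abs_div, abs_of_pos hT]
        field_simp
      _ ≤ _ := by gcongr; norm_num

lemma integrable_exp_neg_sq_sub (r : ℝ) :
    Integrable fun u : ℝ => Real.exp (-u ^ 2 / 4 - r * u) := by
  refine (integrable_cexp_quadratic' (b := -1 / 4) (by norm_num) (-r : ℝ) 0).norm.congr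
    (ae_of_all _ fun u => ?_)
  dsimp only
  rw [Complex.norm_exp]
  have : (-1 / 4 * (u : ℂ) ^ 2 + ((-r : ℝ) : ℂ) * u + 0) = ((-u ^ 2 / 4 - r * u : ℝ) : ℂ) := by
    push_cast; ring
  rw [this, Complex.ofReal_re]

lemma integrable_abs_pow_mul_exp (r : ℝ) :
    Integrable fun u : ℝ => |u| ^ 3 * Real.exp (-u ^ 2 / 4) * Real.exp (-r * u) := by
  refine (((integrable_exp_neg_sq_sub (r - 1)).add (integrable_exp_neg_sq_sub (r + 1))).const_mul
    6).mono' (by fun_prop) (ae_of_all _ fun u => ?_)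
  have h1 := Real.pow_div_factorial_le_exp |u| (abs_nonneg u) 3
  rw [div_le_iff₀ (by positivity)] at h1
  have h2 : Real.exp |u| ≤ Real.exp u + Real.exp (-u) := by
    rcases abs_choice u with h | h <;> rw [h] <;>
      linarith [Real.exp_pos u, Real.exp_pos (-u)]
  have h3 : |u| ^ 3 ≤ 6 * (Real.exp u + Real.exp (-u)) := by
    norm_num [Nat.factorial] at h1
    linarith
  rw [Real.norm_of_nonneg (by positivity)]
  calc _ ≤ 6 * (Real.exp u + Real.exp (-u)) * Real.exp (-u ^ 2 / 4) * Real.exp (-r * u) := by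
        gcongr
    _ = 6 * (Real.exp u * Real.exp (-u ^ 2 / 4) * Real.exp (-r * u) +
          Real.exp (-u) * Real.exp (-u ^ 2 / 4) * Real.exp (-r * u)) := by ring
    _ = _ := by
      simp only [Pi.add_apply, ← Real.exp_add]
      ring_nf

/-- The maximum of `t^n exp (-t²/4)`, attained at `t = √(2n)`. -/
noncomputable def peakHeight (n : ℕ) : ℝ := √(2 * n) ^ n * Real.exp (-√(2 * n) ^ 2 / 4)

lemma peakHeight_pos {n : ℕ} (hn : n ≠ 0) : 0 < peakHeight n := by
  have hT : 0 < √(2 * n) := Real.sqrt_pos.2 (by positivity)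
  unfold peakHeight
  positivity

lemma cylInt_eq_integral_peak {n : ℕ} (hn : n ≠ 0) (s : ℂ) :
    cylInt n s = peakHeight n * Complex.exp (-s * √(2 * n)) *
      ∫ u : ℝ, (peak n u : ℂ) * Complex.exp (-s * u) := by
  have hT : (√(2 * n) : ℂ) ≠ 0 := by
    have : 0 < √(2 * n) := Real.sqrt_pos.2 (by positivity)
    exact_mod_cast this.ne'
  rw [cylInt, ← integral_indicator measurableSet_Ioi,
    ← integral_add_left_eq_self _ √(2 * n), ← integral_const_mul]
  refine integral_congr_ae (ae_of_all _ fun u => ?_)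
  simp only [Set.indicator_apply, Set.mem_Ioi, peak]
  split_ifs with h
  · unfold peakHeight
    generalize √(2 * n) = T at *
    push_cast
    rw [show (T : ℂ) + u = T * (1 + u / T) by field_simp, mul_pow,
      show -((T : ℂ) * (1 + u / T)) ^ 2 / 4 - s * (T * (1 + u / T)) =
        -T ^ 2 / 4 + -s * T + (-T * u / 2 - u ^ 2 / 4) + -s * u by field_simp; ring,
      Complex.exp_add, Complex.exp_add, Complex.exp_add]
    ring
  · simp

lemma integral_gaussian_mul_exp (s : ℂ) :
    ∫ u : ℝ, (Real.exp (-u ^ 2 / 2) : ℂ) * Complex.exp (-s * u) =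
      √(2 * Real.pi) * Complex.exp (s ^ 2 / 2) := by
  have h := integral_cexp_quadratic (b := -1 / 2) (by norm_num) (-s) 0
  have e : (Real.pi / -(-1 / 2) : ℂ) ^ (1 / 2 : ℂ) = √(2 * Real.pi) := by
    rw [Real.sqrt_eq_rpow, Complex.ofReal_cpow (by positivity)]
    push_cast
    congr 1
    ring
  rw [e] at h
  rw [show s ^ 2 / 2 = 0 - (-s) ^ 2 / (4 * (-1 / 2)) by ring, ← h]
  refine integral_congr_ae (ae_of_all _ fun u => ?_)
  dsimp only
  rw [Complex.ofReal_exp, ← Complex.exp_add]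
  push_cast
  ring_nf

lemma norm_integral_peak_sub_le (s : ℂ) : ∃ C, ∀ n : ℕ, n ≠ 0 →
    ‖(∫ u : ℝ, (peak n u : ℂ) * Complex.exp (-s * u)) - √(2 * Real.pi) * Complex.exp (s ^ 2 / 2)‖ ≤
      C / √(2 * n) := by
  refine ⟨8 * ∫ u : ℝ, |u| ^ 3 * Real.exp (-u ^ 2 / 4) * Real.exp (-s.re * u), fun n hn => ?_⟩
  have hnorm : ∀ u : ℝ, ‖Complex.exp (-s * u)‖ = Real.exp (-s.re * u) := fun u => by
    rw [Complex.norm_exp, Complex.re_mul_ofReal, Complex.neg_re]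
  have hI := integrable_exp_neg_sq_sub s.re
  have h1 : Integrable fun u : ℝ => (peak n u : ℂ) * Complex.exp (-s * u) := by
    refine hI.mono' ?_ (ae_of_all _ fun u => ?_)
    · have := measurable_peak n
      exact (Measurable.mul (by fun_prop) (by fun_prop)).aestronglyMeasurable
    · rw [norm_mul, hnorm, Complex.norm_real, Real.norm_of_nonneg (peak_nonneg n u),
        sub_eq_add_neg, Real.exp_add, neg_mul]
      gcongr
      exact peak_le n hn u
  have h2 : Integrable fun u : ℝ => (Real.exp (-u ^ 2 / 2) : ℂ) * Complex.exp (-s * u) := by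
    refine hI.mono' (by fun_prop) (ae_of_all _ fun u => ?_)
    rw [norm_mul, hnorm, Complex.norm_real, Real.norm_of_nonneg (by positivity),
      sub_eq_add_neg, Real.exp_add, neg_mul]
    exact mul_le_mul_of_nonneg_right (Real.exp_le_exp.2 (by nlinarith [sq_nonneg u]))
      (Real.exp_pos _).le
  rw [← integral_gaussian_mul_exp, ← integral_sub h1 h2, mul_div_right_comm, ← integral_const_mul]
  refine norm_integral_le_of_norm_le ((integrable_abs_pow_mul_exp s.re).const_mul _)
    (ae_of_all _ fun u => ?_)
  rw [← sub_mul, norm_mul, hnorm, ← Complex.ofReal_sub, Complex.norm_real, Real.norm_eq_abs,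
    ← mul_assoc]
  gcongr
  exact abs_peak_sub_le n hn u

/-- `‖J_n(s)‖` divided by its Laplace approximation. -/
noncomputable def laplaceRatio (s : ℂ) (n : ℕ) : ℝ :=
  ‖cylInt n s‖ * Real.exp (s.re * √(2 * n)) /
    (peakHeight n * (√(2 * Real.pi) * ‖Complex.exp (s ^ 2 / 2)‖))

lemma rpow_neg_half_eq (n : ℕ) : (n : ℝ) ^ (-(1 / 2) : ℝ) = 1 / √n := by
  rw [Real.rpow_neg (Nat.cast_nonneg n), ← Real.sqrt_eq_rpow, one_div]

lemma isBigO_laplaceRatio_sub_one (s : ℂ) :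
    (fun n => laplaceRatio s n - 1) =O[atTop] fun n : ℕ => (n : ℝ) ^ (-(1 / 2) : ℝ) := by
  obtain ⟨C, hC⟩ := norm_integral_peak_sub_le s
  set W := √(2 * Real.pi) * ‖Complex.exp (s ^ 2 / 2)‖ with hW
  have hW0 : 0 < W := mul_pos (Real.sqrt_pos.2 (by positivity)) (by simp)
  have hWn : ‖(√(2 * Real.pi) : ℂ) * Complex.exp (s ^ 2 / 2)‖ = W := by
    rw [norm_mul, Complex.norm_real, Real.norm_of_nonneg (Real.sqrt_nonneg _)]
  refine IsBigO.of_bound (|C| / √2 / W) ?_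
  filter_upwards [eventually_ne_atTop 0] with n hn
  have hp := peakHeight_pos hn
  have h1 : laplaceRatio s n = ‖∫ u : ℝ, (peak n u : ℂ) * Complex.exp (-s * u)‖ / W := by
    rw [laplaceRatio, cylInt_eq_integral_peak hn, norm_mul, norm_mul, Complex.norm_real,
      Real.norm_of_nonneg hp.le, Complex.norm_exp, Complex.re_mul_ofReal, Complex.neg_re, neg_mul,
      Real.exp_neg, ← hW]
    have := Real.exp_pos (s.re * √(2 * n))
    field_simp
  have h2 := (abs_norm_sub_norm_le _ _).trans (hC n hn)
  rw [hWn] at h2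
  rw [h1, rpow_neg_half_eq, div_sub_one hW0.ne', Real.norm_eq_abs, abs_div, abs_of_pos hW0,
    Real.norm_of_nonneg (by positivity), div_mul_eq_mul_div]
  gcongr
  refine h2.trans ?_
  rw [Real.sqrt_mul zero_le_two, mul_one_div, div_div]
  gcongr
  exact le_abs_self C

lemma isBigO_mul_sub_one {f g r : ℕ → ℝ} (hr : Tendsto r atTop (𝓝 0))
    (hf : (fun n => f n - 1) =O[atTop] r) (hg : (fun n => g n - 1) =O[atTop] r) :
    (fun n => f n * g n - 1) =O[atTop] r := by
  have h1 : (fun n => (f n - 1) * (g n - 1)) =O[atTop] r := by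
    simpa using hf.mul (hg.trans (hr.isBigO_one ℝ))
  refine ((h1.add hf).add hg).congr_left fun n => ?_
  ring

lemma isBigO_inv_sub_one {f r : ℕ → ℝ} (hr : Tendsto r atTop (𝓝 0))
    (hf : (fun n => f n - 1) =O[atTop] r) : (fun n => (f n)⁻¹ - 1) =O[atTop] r := by
  have h1 : Tendsto f atTop (𝓝 1) := by simpa using (hf.trans_tendsto hr).add_const 1
  have h2 : (fun n => (f n - 1) * -(f n)⁻¹) =O[atTop] r := by
    simpa using hf.mul ((h1.inv₀ one_ne_zero).neg.isBigO_one ℝ)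
  refine h2.congr' ?_ .rfl
  filter_upwards [h1.eventually_ne one_ne_zero] with n hn
  field_simp
  ring

lemma tendsto_rpow_neg_half : Tendsto (fun n : ℕ => (n : ℝ) ^ (-(1 / 2) : ℝ)) atTop (𝓝 0) :=
  (tendsto_rpow_neg_atTop (by norm_num)).comp tendsto_natCast_atTop_atTop

/-- Midpoint log-convexity of the Gamma function. -/
lemma Gamma_midpoint_sq_le {x y : ℝ} (hx : 0 < x) (hy : 0 < y) :
    Real.Gamma ((x + y) / 2) ^ 2 ≤ Real.Gamma x * Real.Gamma y := by
  have h := Real.Gamma_mul_add_mul_le_rpow_Gamma_mul_rpow_Gamma hx hy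
    (by norm_num : (0 : ℝ) < 1 / 2) (by norm_num : (0 : ℝ) < 1 / 2) (by norm_num)
  rw [← Real.sqrt_eq_rpow, ← Real.sqrt_eq_rpow, show 1 / 2 * x + 1 / 2 * y = (x + y) / 2 by ring,
    ← Real.sqrt_mul (Real.Gamma_pos_of_pos hx).le] at h
  have h0 := Real.Gamma_pos_of_pos (show 0 < (x + y) / 2 by positivity)
  exact (Real.le_sqrt' h0).1 h

/-- `√a Γ(a) / Γ(a + 1/2) = 1 + O(n^{-1/2})` for `a = (n + 1) / 2`. Log-convexity on the intervals
`[a, a + 1]` and `[a - 1/2, a + 1/2]` puts the ratio between `1` and `1 + 1 / n`. -/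
lemma isBigO_Gamma_ratio_sub_one :
    (fun n : ℕ => √(((n : ℝ) + 1) / 2) * Real.Gamma (((n : ℝ) + 1) / 2) /
        Real.Gamma (((n : ℝ) + 1) / 2 + 1 / 2) - 1)
      =O[atTop] fun n : ℕ => (n : ℝ) ^ (-(1 / 2) : ℝ) := by
  refine IsBigO.of_bound 1 ?_
  filter_upwards [eventually_ne_atTop 0] with n hn
  have hn1 : (1 : ℝ) ≤ n := by exact_mod_cast Nat.one_le_iff_ne_zero.2 hn
  have ha : 0 < ((n : ℝ) + 1) / 2 := by positivity
  have hb : 0 < ((n : ℝ) + 1) / 2 - 1 / 2 := by linarith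
  have h1 := Gamma_midpoint_sq_le ha (show 0 < ((n : ℝ) + 1) / 2 + 1 by positivity)
  have h2 := Gamma_midpoint_sq_le hb (show 0 < ((n : ℝ) + 1) / 2 + 1 / 2 by positivity)
  have h3 := Real.Gamma_add_one hb.ne'
  rw [Real.Gamma_add_one ha.ne', show (((n : ℝ) + 1) / 2 + (((n : ℝ) + 1) / 2 + 1)) / 2 =
    ((n : ℝ) + 1) / 2 + 1 / 2 by ring] at h1
  rw [show (((n : ℝ) + 1) / 2 - 1 / 2 + (((n : ℝ) + 1) / 2 + 1 / 2)) / 2 =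
    ((n : ℝ) + 1) / 2 by ring] at h2
  rw [show ((n : ℝ) + 1) / 2 - 1 / 2 + 1 = ((n : ℝ) + 1) / 2 + 1 / 2 by ring] at h3
  have hA := Real.Gamma_pos_of_pos ha
  have hB := Real.Gamma_pos_of_pos (show 0 < ((n : ℝ) + 1) / 2 + 1 / 2 by positivity)
  have hs : √(((n : ℝ) + 1) / 2) ^ 2 = ((n : ℝ) + 1) / 2 := Real.sq_sqrt ha.le
  have hs0 : 0 ≤ √(((n : ℝ) + 1) / 2) := Real.sqrt_nonneg _
  generalize √(((n : ℝ) + 1) / 2) = q at *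
  generalize Real.Gamma (((n : ℝ) + 1) / 2) = A at *
  generalize Real.Gamma (((n : ℝ) + 1) / 2 + 1 / 2) = B at *
  generalize Real.Gamma (((n : ℝ) + 1) / 2 - 1 / 2) = D at *
  have h4 : 1 ≤ q * A / B := by
    rw [le_div_iff₀ hB, one_mul]
    refine le_of_sq_le_sq ?_ (by positivity)
    rw [mul_pow, hs]
    linarith
  have h5 : n * A ^ 2 ≤ 2 * B ^ 2 := by
    have : (n : ℝ) * D = 2 * B := by rw [h3]; ring
    calc n * A ^ 2 ≤ n * (D * B) := by gcongr
      _ = 2 * B ^ 2 := by rw [← mul_assoc, this]; ring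
  have h6 : q * A / B ≤ 1 + 1 / n := by
    rw [div_le_iff₀ hB]
    refine le_of_sq_le_sq ?_ (by positivity)
    rw [mul_pow, hs]
    have h7 : (1 + 1 / (n : ℝ)) * B ^ 2 ≤ ((1 + 1 / n) * B) ^ 2 := by
      rw [mul_pow]
      gcongr
      exact le_self_pow₀ (by simp) two_ne_zero
    refine le_trans ?_ h7
    calc ((n : ℝ) + 1) / 2 * A ^ 2 = (n + 1) / (2 * n) * (n * A ^ 2) := by field_simp
      _ ≤ (n + 1) / (2 * n) * (2 * B ^ 2) := by gcongr
      _ = (1 + 1 / n) * B ^ 2 := by field_simp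
  rw [one_mul, rpow_neg_half_eq, Real.norm_of_nonneg (by linarith),
    Real.norm_of_nonneg (by positivity)]
  have h8 : 1 / (n : ℝ) ≤ 1 / √n := by
    gcongr
    exact Real.sqrt_le_iff.2 ⟨by linarith, by nlinarith⟩
  linarith

/-- Replacing `√(2n)` by `√(2(n+1))` in the exponent costs a factor `1 + O(n^{-1/2})`. -/
lemma isBigO_exp_sqrt_sub_one (r : ℝ) :
    (fun n : ℕ => Real.exp (r * (√(2 * ((n : ℝ) + 1)) - √(2 * n))) - 1)
      =O[atTop] fun n : ℕ => (n : ℝ) ^ (-(1 / 2) : ℝ) := by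
  have h1 : (fun n : ℕ => r * (√(2 * ((n : ℝ) + 1)) - √(2 * n)))
      =O[atTop] fun n : ℕ => (n : ℝ) ^ (-(1 / 2) : ℝ) := by
    refine IsBigO.of_bound (|r| * 2) ?_
    filter_upwards [eventually_ne_atTop 0] with n hn
    have hn1 : (1 : ℝ) ≤ n := by exact_mod_cast Nat.one_le_iff_ne_zero.2 hn
    rw [rpow_neg_half_eq, norm_mul, Real.norm_eq_abs, mul_assoc,
      Real.norm_of_nonneg (r := 1 / √n) (by positivity)]
    gcongr
    have ha : √(2 * (n : ℝ)) ≤ √(2 * ((n : ℝ) + 1)) := Real.sqrt_le_sqrt (by linarith)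
    rw [Real.norm_of_nonneg (by linarith), mul_one_div,
      le_div_iff₀ (Real.sqrt_pos.2 (by linarith))]
    have hb : √(n : ℝ) ≤ √(2 * (n : ℝ)) := Real.sqrt_le_sqrt (by linarith)
    have e1 := Real.sq_sqrt (show (0 : ℝ) ≤ 2 * (n + 1) by positivity)
    have e2 := Real.sq_sqrt (show (0 : ℝ) ≤ 2 * n by positivity)
    nlinarith [Real.sqrt_nonneg (n : ℝ)]
  have h2 : (fun x : ℝ => Real.exp x - 1) =O[𝓝 0] fun x => x := by
    simpa using (Real.hasDerivAt_exp 0).isBigO_sub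
  exact (h2.comp_tendsto (h1.trans_tendsto tendsto_rpow_neg_half)).trans h1

lemma norm_cylInt_zero (n : ℕ) : ‖cylInt n 0‖ = 2 ^ n * Real.Gamma ((n + 1) / 2) := by
  have h : cylInt n 0 = ((∫ t : ℝ in Set.Ioi 0, t ^ n * Real.exp (-t ^ 2 / 4) : ℝ) : ℂ) := by
    rw [cylInt, ← integral_complex_ofReal]
    refine integral_congr_ae (ae_of_all _ fun t => ?_)
    push_cast
    ring_nf
  have h0 := Real.Gamma_pos_of_pos (show 0 < ((n : ℝ) + 1) / 2 by positivity)
  rw [h, integral_pow_mul_exp_neg_sq, Complex.norm_real, Real.norm_of_nonneg (by positivity)]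

/-- Both half planes reduce to a parabolic cylinder integral in the right half plane. -/
lemma norm_hermiteCauchy {z : ℂ} (hz : z.im ≠ 0) : ∃ s : ℂ, s.re = |z.im| ∧ s ^ 2 = -z ^ 2 ∧
    ∀ n, ‖hermiteCauchy n z‖ = ‖cylInt n s‖ / (2 * √Real.pi) := by
  have key : ∀ w : ℂ, 0 < w.im → ∀ n,
      ‖hermiteCauchy n w‖ = ‖cylInt n (-I * w)‖ / (2 * √Real.pi) := by
    intro w hw n
    rw [hermiteCauchy_of_im_pos n hw, norm_mul, norm_div, norm_neg, norm_pow, norm_neg,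
      Complex.norm_I, one_pow, norm_mul, Complex.norm_ofNat, Complex.norm_real,
      Real.norm_of_nonneg (Real.sqrt_nonneg _), one_div_mul_eq_div]
  rcases hz.lt_or_gt with h | h
  · refine ⟨-I * -z, by simp [abs_of_neg h], by rw [mul_pow]; simp, fun n => ?_⟩
    have h1 := key (-z) (by simpa using h) n
    rwa [hermiteCauchy_neg, norm_mul, norm_pow, norm_neg, norm_one, one_pow, one_mul] at h1
  · exact ⟨-I * z, by simp [abs_of_pos h], by rw [mul_pow]; simp, key z h⟩

/-- With `J_n(0) = 2^n Γ((n+1)/2)` as reference value, the height of the peak cancels, and the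
duplication formula and the ratio of Gamma functions bring the result to the stated shape. -/
lemma norm_hermiteCauchy_asymptotics {z : ℂ} (hz : z.im ≠ 0) :
    ∃ E : ℕ → ℝ, E =O[atTop] (fun n : ℕ => (n : ℝ) ^ (-(1 / 2) : ℝ)) ∧
      ∀ n : ℕ, ‖hermiteCauchy n z‖ =
        Real.Gamma ((n : ℝ) + 1) * ‖Complex.exp (-z ^ 2 / 2)‖ /
            (Real.Gamma (((n : ℝ) + 1) / 2) * √(2 * ((n : ℝ) + 1))) *
          Real.exp (-|z.im| * √(2 * ((n : ℝ) + 1))) * (1 + E n) := by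
  obtain ⟨s, hs, hs2, hΦ⟩ := norm_hermiteCauchy hz
  set R : ℕ → ℝ := fun n => Real.Gamma ((n : ℝ) + 1) * ‖Complex.exp (-z ^ 2 / 2)‖ /
            (Real.Gamma (((n : ℝ) + 1) / 2) * √(2 * ((n : ℝ) + 1))) *
          Real.exp (-|z.im| * √(2 * ((n : ℝ) + 1))) with hR
  -- the prediction never vanishes, so the equation determines `E n`, for `n = 0` too
  have hR0 : ∀ n, R n ≠ 0 := fun n => by
    have h1 := Real.Gamma_pos_of_pos (show 0 < (n : ℝ) + 1 by positivity)
    have h2 := Real.Gamma_pos_of_pos (show 0 < ((n : ℝ) + 1) / 2 by positivity)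
    have h3 : 0 < √(2 * ((n : ℝ) + 1)) := Real.sqrt_pos.2 (by positivity)
    have h4 : 0 < ‖Complex.exp (-z ^ 2 / 2)‖ := by simp
    positivity
  refine ⟨fun n => ‖hermiteCauchy n z‖ / R n - 1, ?_, fun n => ?_⟩
  · have hr := tendsto_rpow_neg_half
    refine (isBigO_mul_sub_one hr (isBigO_mul_sub_one hr (isBigO_mul_sub_one hr
      (isBigO_laplaceRatio_sub_one s) (isBigO_inv_sub_one hr (isBigO_laplaceRatio_sub_one 0)))
      isBigO_Gamma_ratio_sub_one) (isBigO_exp_sqrt_sub_one s.re)).congr' ?_ .rfl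
    filter_upwards [eventually_ne_atTop 0] with n hn
    congr 1
    have hp := peakHeight_pos hn
    have hd := Gamma_half_mul_Gamma_half n
    have hA := Real.Gamma_pos_of_pos (show 0 < ((n : ℝ) + 1) / 2 by positivity)
    have hB := Real.Gamma_pos_of_pos (show 0 < ((n : ℝ) + 1) / 2 + 1 / 2 by positivity)
    have hw : 0 < ‖Complex.exp (-z ^ 2 / 2)‖ := by simp
    have hpi : 0 < √Real.pi := Real.sqrt_pos.2 Real.pi_pos
    have h2pi : 0 < √(2 * Real.pi) := Real.sqrt_pos.2 (by positivity)
    have hq : √(2 * ((n : ℝ) + 1)) = 2 * √(((n : ℝ) + 1) / 2) := by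
      rw [show 2 * ((n : ℝ) + 1) = 2 ^ 2 * (((n : ℝ) + 1) / 2) by ring,
        Real.sqrt_mul (by positivity), Real.sqrt_sq zero_le_two]
    have hq0 : 0 < √(((n : ℝ) + 1) / 2) := Real.sqrt_pos.2 (by positivity)
    have hf : (0 : ℝ) < n.factorial := by exact_mod_cast n.factorial_pos
    simp only [hR, laplaceRatio, hΦ, norm_cylInt_zero, hs2, hs, Real.Gamma_nat_eq_factorial,
      Complex.zero_re, zero_mul, Real.exp_zero, mul_sub, Real.exp_sub, neg_mul, Real.exp_neg,
      mul_one, ne_eq, OfNat.ofNat_ne_zero, not_false_eq_true, zero_pow, zero_div,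
      Complex.exp_zero, norm_one]
    have hx := Real.exp_pos (|z.im| * √(2 * ((n : ℝ) + 1)))
    have hy := Real.exp_pos (|z.im| * √(2 * (n : ℝ)))
    generalize Real.exp (|z.im| * √(2 * ((n : ℝ) + 1))) = X at *
    generalize Real.exp (|z.im| * √(2 * (n : ℝ))) = Y at *
    rw [hq]
    generalize √(((n : ℝ) + 1) / 2) = q at *
    generalize Real.Gamma (((n : ℝ) + 1) / 2) = A at *
    generalize Real.Gamma (((n : ℝ) + 1) / 2 + 1 / 2) = B at *
    generalize ‖Complex.exp (-z ^ 2 / 2)‖ = w at *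
    generalize √Real.pi = p at *
    generalize √(2 * Real.pi) = p2 at *
    generalize peakHeight n = h at *
    field_simp
    linear_combination -‖cylInt n s‖ * hd
  · have := hR0 n
    change _ = R n * _
    field_simp
    ring

end HermiteCauchy

theorem mainTheorem9 :
    -- (i) Plemelj relations
    (∀ (n : ℕ) (x : ℝ),
      (∃ L : ℝ, HasCauchyPV (fun y : ℝ => hermiteWeight y * hermiteH n y / (x - y)) x L ∧
        Tendsto
          (fun ε : ℝ => hermiteCauchy n ((x : ℂ) - Complex.I * (ε : ℂ)) +
            hermiteCauchy n ((x : ℂ) + Complex.I * (ε : ℂ)))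
          (𝓝[>] 0) (𝓝 (1 / ((Real.pi : ℂ) * Complex.I) * (L : ℂ)))) ∧
      Tendsto
        (fun ε : ℝ => hermiteCauchy n ((x : ℂ) - Complex.I * (ε : ℂ)) -
          hermiteCauchy n ((x : ℂ) + Complex.I * (ε : ℂ)))
        (𝓝[>] 0) (𝓝 ((hermiteWeight x * hermiteH n x : ℝ) : ℂ))) ∧
    -- (ii) behaviour as `z → ∞` in `ℂ ∖ ℝ`
    (∀ n : ℕ,
      (fun z : ℂ => hermiteCauchy n z -
        (n.factorial : ℂ) / (2 * (Real.sqrt Real.pi : ℂ) * Complex.I * z ^ (n + 1)))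
      =O[Bornology.cobounded ℂ ⊓ 𝓟 {z : ℂ | z.im ≠ 0}] (fun z : ℂ => (z ^ (n + 2))⁻¹)) ∧
    -- (iii) representation by Kummer's function of the second kind
    (∀ (n : ℕ) (z : ℂ),
      (0 < z.im → hermiteCauchy n z =
        Complex.Gamma ((n : ℂ) + 1) / (2 * (Real.sqrt Real.pi : ℂ)) *
          kummerU (((n : ℂ) + 1) / 2) (1 / 2) (-z ^ 2) *
          Complex.exp (-((n : ℂ) + 2) * (Real.pi : ℂ) * Complex.I / 2)) ∧
      (z.im < 0 → hermiteCauchy n z =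
        Complex.Gamma ((n : ℂ) + 1) / (2 * (Real.sqrt Real.pi : ℂ)) *
          kummerU (((n : ℂ) + 1) / 2) (1 / 2) (-z ^ 2) *
          Complex.exp ((n : ℂ) * (Real.pi : ℂ) * Complex.I / 2))) ∧
    -- (iv) behaviour as `n → ∞`
    (∀ z : ℂ, z.im ≠ 0 →
      ∃ E : ℕ → ℝ, E =O[atTop] (fun n : ℕ => (n : ℝ) ^ (-(1 / 2) : ℝ)) ∧
        ∀ n : ℕ, ‖hermiteCauchy n z‖ =
          Real.Gamma ((n : ℝ) + 1) * ‖Complex.exp (-z ^ 2 / 2)‖ /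
              (Real.Gamma (((n : ℝ) + 1) / 2) * Real.sqrt (2 * ((n : ℝ) + 1))) *
            Real.exp (-|z.im| * Real.sqrt (2 * ((n : ℝ) + 1))) * (1 + E n)) :=
  ⟨fun n x => ⟨HermiteCauchy.plemelj_add n x, HermiteCauchy.plemelj_sub n x⟩,
    HermiteCauchy.hermiteCauchy_sub_isBigO,
    fun n _ => ⟨HermiteCauchy.hermiteCauchy_eq_kummerU_of_im_pos n,
      HermiteCauchy.hermiteCauchy_eq_kummerU_of_im_neg n⟩,
    fun _ => HermiteCauchy.norm_hermiteCauchy_asymptotics⟩
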